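/- Let $(R,\mathfrak m)$ be a (Noetherian) Cohen–Macaulay local ring with $\dim R=1$ possessing a canonical ideal $I$ (a proper ideal isomorphic, as an $R$-module, to the canonical module of $R$) which contains a parameter ideal $(a)$ as a reduction (that is, $a\in I$, $(a)$ is $\mathfrak m$-primary and $I^{r+1}=aI^r$ for some $r\ge 0$). Suppose that $R$ has minimal multiplicity, i.e. its multiplicity $\mathrm e(R)$ equals the minimal number of generators of $\mathfrak m$. Set $$B=\bigcup_{j\ge 0}\,[\mathfrak m^j:\mathfrak m^j],$$ where the colons are formed in the total ring of fractions of $R$. Suppose that $B$ is a local ring, with maximal ideal $\mathfrak n$, and that $R/\mathfrak m\cong B/\mathfrak n$ as $R$-algebras. Let $n\ge 2$ be an integer. Then $R$ is an $n$-Goto ring if and only if $B$ is an $(n-1)$-Goto ring. Here, for an integer $m\ge 0$, a Cohen–Macaulay local ring $(A,\mathfrak m_A)$ of dimension $d>0$ is called an $m$-Goto ring if there are a canonical ideal $I_A$ of $A$ and a parameter ideal $Q=(a_1,\dots,a_d)$ of $A$ such that $a_1\in I_A$ and, with $J=I_A+Q$ and $\mathcal T=A[Qt]$ the Rees algebra of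 $Q$, the Sally module $$\mathcal S_Q(J)=J\,A[Jt]/J\,A[Qt]\cong\bigoplus_{i\ge 1}J^{i+1}/JQ^i$$ is generated over $\mathcal T$ by its homogeneous elements of degree one and has rank $m$, i.e. its localization at the prime $\mathfrak m_A\mathcal T$ has length $m$ over $\mathcal T_{\mathfrak m_A\mathcal T}$. -/

import Mathlib

open Polynomial

universe u

noncomputable section

section LocalNotions

variable (A : Type u) [CommRing A] [IsLocalRing A]

/-- A Cohen-Macaulay local ring: a Noetherian local ring whose maximal ideal contains a regular
sequence of length equal to the Krull dimension. -/
def IsCohenMacaulayLocal : Prop :=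
  IsNoetherianRing A ∧
    ∃ rs : List A, (∀ r ∈ rs, r ∈ IsLocalRing.maximalIdeal A) ∧
      RingTheory.Sequence.IsRegular A rs ∧ (rs.length : WithBot ℕ∞) = ringKrullDim A

/-- A canonical module of a (Cohen-Macaulay) local ring `A` with residue field `k`: a finitely
generated `A`-module `M` such that `Ext^i_A(k, M)` is one-dimensional over `k` for `i = dim A`
and zero for all other `i` (i.e. a maximal Cohen-Macaulay module of type one and of finite
injective dimension). -/
def IsCanonicalModule (M : Type u) [AddCommGroup M] [Module A M] : Prop :=
  Module.Finite A M ∧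
    ∀ i : ℕ,
      ((i : WithBot ℕ∞) = ringKrullDim A →
        Module.length A (CategoryTheory.Abelian.Ext
          (ModuleCat.of A (IsLocalRing.ResidueField A)) (ModuleCat.of A M) i) = 1) ∧
      ((i : WithBot ℕ∞) ≠ ringKrullDim A →
        Module.length A (CategoryTheory.Abelian.Ext
          (ModuleCat.of A (IsLocalRing.ResidueField A)) (ModuleCat.of A M) i) = 0)

/-- `e` is the (Hilbert-Samuel) multiplicity of `A`: for `d = dim A` there are integers
`e_0 = e, e_1, …, e_d` with
`ℓ(A / 𝔪 ^ (n + 1)) = ∑_{i ≤ d} (-1) ^ i * e_i * ((n + d - i) choose (d - i))` for `n ≫ 0`. -/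
def HasMultiplicity (e : ℤ) : Prop :=
  ∃ (d : ℕ) (c : ℕ → ℤ), ringKrullDim A = d ∧ c 0 = e ∧
    ∀ᶠ n : ℕ in Filter.atTop,
      ((Module.length A (A ⧸ IsLocalRing.maximalIdeal A ^ (n + 1))).toNat : ℤ) =
        ∑ i ∈ Finset.range (d + 1), (-1) ^ i * c i * ((n + d - i).choose (d - i) : ℤ)

/-- A one-dimensional Cohen-Macaulay local ring has minimal multiplicity if its multiplicity
equals the minimal number of generators of its maximal ideal. -/
def HasMinimalMultiplicity : Prop :=
  HasMultiplicity A ((IsLocalRing.maximalIdeal A).spanFinrank : ℤ)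

variable {A}

/-- A canonical ideal: a proper ideal that is, as a module, a canonical module. -/
def IsCanonicalIdeal (I : Ideal A) : Prop :=
  I ≠ ⊤ ∧ IsCanonicalModule A I

/-- `a_1, …, a_d` is a system of parameters of `A`: `d = dim A` and the ideal
`(a_1, …, a_d)` is primary to the maximal ideal. -/
def IsSystemOfParameters {d : ℕ} (a : Fin d → A) : Prop :=
  ringKrullDim A = d ∧ (Ideal.span (Set.range a)).radical = IsLocalRing.maximalIdeal A

end LocalNotions

section Reductions

variable {A : Type u} [CommRing A]

/-- `Q` is a reduction of `J`. -/
def IsReduction (Q J : Ideal A) : Prop :=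
  Q ≤ J ∧ ∃ r : ℕ, J ^ (r + 1) = Q * J ^ r

/-- The Rees algebra `R(Q) = A[Qt]`, as a type of its own. -/
def ReesRing (Q : Ideal A) : Type u := ↥(reesAlgebra Q)

instance ReesRing.instCommRing (Q : Ideal A) : CommRing (ReesRing Q) :=
  inferInstanceAs (CommRing ↥(reesAlgebra Q))

instance ReesRing.instAlgebra (Q : Ideal A) : Algebra A (ReesRing Q) :=
  inferInstanceAs (Algebra A ↥(reesAlgebra Q))

/-- `A[t]` as a module over the Rees algebra, by multiplication of polynomials. -/
instance ReesRing.instModule (Q : Ideal A) : Module (ReesRing Q) A[X] :=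
  inferInstanceAs (Module ↥(reesAlgebra Q) A[X])

/-- `J R(J) = ⨁ J ^ (i + 1) t ^ i` inside `A[t]`, as a module over the Rees algebra `R(Q)`. -/
def sallyNumerator (Q J : Ideal A) (h : Q ≤ J) : Submodule (ReesRing Q) A[X] where
  carrier := {f | ∀ i, f.coeff i ∈ J ^ (i + 1)}
  zero_mem' := fun i => by simp
  add_mem' := fun {f g} hf hg i => by
    rw [coeff_add]
    exact Ideal.add_mem _ (hf i) (hg i)
  smul_mem' := fun c f hf i => by
    change (c.1 * f).coeff i ∈ _
    rw [coeff_mul]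
    refine Ideal.sum_mem _ fun x hx => ?_
    rw [← Finset.HasAntidiagonal.mem_antidiagonal.mp hx, add_assoc, pow_add]
    exact Ideal.mul_mem_mul (Ideal.pow_right_mono h _ (c.2 x.1)) (hf x.2)

/-- `J R(Q) = ⨁ J Q ^ i t ^ i` inside `A[t]`, as a module over the Rees algebra `R(Q)`. -/
def sallyDenominator (Q J : Ideal A) : Submodule (ReesRing Q) A[X] where
  carrier := {f | ∀ i, f.coeff i ∈ J * Q ^ i}
  zero_mem' := fun i => by simp
  add_mem' := fun {f g} hf hg i => by
    rw [coeff_add]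
    exact Ideal.add_mem _ (hf i) (hg i)
  smul_mem' := fun c f hf i => by
    change (c.1 * f).coeff i ∈ _
    rw [coeff_mul]
    refine Ideal.sum_mem _ fun x hx => ?_
    rw [← Finset.HasAntidiagonal.mem_antidiagonal.mp hx, pow_add, mul_left_comm]
    exact Ideal.mul_mem_mul (c.2 x.1) (hf x.2)

/-- The Sally module `S_Q(J) = J R(J) / J R(Q) = ⨁_{i ≥ 1} J ^ (i + 1) / J Q ^ i` of `J` with
respect to `Q`, a module over the Rees algebra `R(Q)`. -/
abbrev SallyModule (Q J : Ideal A) (h : Q ≤ J) : Type u :=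
  ↥(sallyNumerator Q J h) ⧸ (sallyDenominator Q J).submoduleOf (sallyNumerator Q J h)

/-- The homogeneous component of degree `i` of the Sally module. -/
def sallyComponent (Q J : Ideal A) (h : Q ≤ J) (i : ℕ) : Set (SallyModule Q J h) :=
  {s | ∃ f : sallyNumerator Q J h,
    (∀ j, j ≠ i → (f : A[X]).coeff j = 0) ∧ Submodule.Quotient.mk f = s}

/-- The Sally module is generated, over the Rees algebra `R(Q)`, by its homogeneous elements of
degree one. -/
def SallyGeneratedInDegreeOne (Q J : Ideal A) (h : Q ≤ J) : Prop :=
  Submodule.span (ReesRing Q) (sallyComponent Q J h 1) = ⊤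

/-- The rank of the Sally module is `n`: the extension `𝔭` of the maximal ideal of `A` to the
Rees algebra `R(Q)` is prime and the localization of the Sally module at `𝔭` has length `n`
over the localization of `R(Q)` at `𝔭`. -/
def SallyHasRank [IsLocalRing A] (Q J : Ideal A) (h : Q ≤ J) (n : ℕ) : Prop :=
  ∃ _ : ((IsLocalRing.maximalIdeal A).map (algebraMap A (ReesRing Q))).IsPrime,
    Module.length
      (Localization.AtPrime ((IsLocalRing.maximalIdeal A).map (algebraMap A (ReesRing Q))))
      (LocalizedModule
        ((IsLocalRing.maximalIdeal A).map (algebraMap A (ReesRing Q))).primeCompl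
        (SallyModule Q J h)) = n

end Reductions

/-- `A` is an `n`-Goto ring: a Cohen-Macaulay local ring of positive dimension with a canonical
ideal `I` and a parameter ideal `Q = (a_1, …, a_d)` such that `a_1 ∈ I` and, for `J = I + Q`,
the Sally module `S_Q(J)` has rank `n` and is generated in degree one. -/
def IsGoto (n : ℕ) (A : Type u) [CommRing A] [IsLocalRing A] : Prop :=
  IsCohenMacaulayLocal A ∧
    ∃ I : Ideal A, IsCanonicalIdeal I ∧
      ∃ (d : ℕ) (a : Fin (d + 1) → A), IsSystemOfParameters a ∧ a 0 ∈ I ∧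
        SallyHasRank (Ideal.span (Set.range a)) (I ⊔ Ideal.span (Set.range a)) le_sup_right n ∧
        SallyGeneratedInDegreeOne (Ideal.span (Set.range a)) (I ⊔ Ideal.span (Set.range a))
          le_sup_right

theorem blowUp_aux {R : Type u} [CommRing R] (I : Ideal R) (x : FractionRing R) (n k : ℕ)
    (h : ∀ y ∈ I ^ n, ∃ z ∈ I ^ n,
      x * algebraMap R (FractionRing R) y = algebraMap R (FractionRing R) z) :
    ∀ y ∈ I ^ (n + k), ∃ z ∈ I ^ (n + k),
      x * algebraMap R (FractionRing R) y = algebraMap R (FractionRing R) z := by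
  intro y hy
  rw [pow_add] at hy ⊢
  refine Submodule.mul_induction_on hy ?_ ?_
  · intro u hu v hv
    obtain ⟨z, hz, e⟩ := h u hu
    exact ⟨z * v, Ideal.mul_mem_mul hz hv, by rw [map_mul, ← mul_assoc, e, map_mul]⟩
  · rintro u v ⟨z, hz, e⟩ ⟨w, hw, e'⟩
    exact ⟨z + w, Ideal.add_mem _ hz hw, by rw [map_add, mul_add, e, e', map_add]⟩

/-- The blow-up `⋃ₙ [I ^ n : I ^ n]` of `I`, formed in the total ring of fractions. -/
def blowUp {R : Type u} [CommRing R] (I : Ideal R) : Subalgebra R (FractionRing R) where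
  carrier := {x | ∃ n : ℕ, ∀ y ∈ I ^ n, ∃ z ∈ I ^ n,
    x * algebraMap R (FractionRing R) y = algebraMap R (FractionRing R) z}
  algebraMap_mem' := fun r => ⟨0, fun y _ => ⟨r * y, by simp, by simp⟩⟩
  add_mem' := by
    rintro a b ⟨n, hn⟩ ⟨m, hm⟩
    refine ⟨n + m, fun y hy => ?_⟩
    obtain ⟨z, hz, e⟩ := blowUp_aux I a n m hn y hy
    obtain ⟨w, hw, e'⟩ := blowUp_aux I b m n hm y (by rwa [add_comm])
    rw [add_comm] at hw
    exact ⟨z + w, Ideal.add_mem _ hz hw, by rw [add_mul, e, e', map_add]⟩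
  mul_mem' := by
    rintro a b ⟨n, hn⟩ ⟨m, hm⟩
    refine ⟨n + m, fun y hy => ?_⟩
    obtain ⟨w, hw, e'⟩ := blowUp_aux I b m n hm y (by rwa [add_comm])
    rw [add_comm] at hw
    obtain ⟨z, hz, e⟩ := blowUp_aux I a n m hn w hw
    exact ⟨z, hz, by rw [mul_assoc, e', e]⟩

end

/-! Write `X : Y` for the colon `X / Y` of fractional ideals in the total ring of fractions. In
dimension one, dividing a canonical ideal `I` by a parameter `a ∈ I` gives a dualizing fractional
ideal `K` containing `1`. The Sally module of `(a)` and `I` is generated in degree one exactly when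
`K³ = K²`, and then its rank is `ℓ(K²/K)`. Thus being `n`-Goto is a statement about one such `K`
(`isGoto_iff_exists_isDualizing`). To make this usable, the Ext definition of a canonical module is
reduced to the condition `ℓ((K : 𝔪)/K) = 1`, from which duality `X ↦ K : X` preserves lengths.

Minimal multiplicity and locality of `B` give `𝔪² = x𝔪`, so `𝔪 = xB`. The residue field may be
finite, so `x` is not available as a general element. Instead a homogeneous reduction of some power
of `𝔪` is found, and locality of `B` extracts from it a generator of `𝔪B`.

If `K² ≠ K`, then `L = KB` equals `K : 𝔪`: it properly contains `K` and `L𝔪 ⊆ K`. Hence `ℓ(L/K) =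
1`. Moreover `L` is dualizing for `B`, because `K : 𝔪` is the dual of a copy of `B`; and lengths
over `R` and `B` agree because the residue fields do. If `K³ = K²`, then `L ⊆ K²`, so `L² = L³ = K²`
and `ℓ(K²/K) = 1 + ℓ(L²/L)` (`IsDualizing.pow_mul_eq`).

Conversely, any dualizing ideal of `B` with stable square is a unit multiple of `L = KB`, where `K`
comes from the given canonical ideal and has stable powers by the reduction hypothesis; so `L³ = L²`
with the same length (`pow_three_eq_and_relLength_eq`). The descent to `K³ = K²`
(`IsDualizing.pow_three_eq_of_mul`) first gives `K⁴ = K³ = L²`, then shows `R : K ⊆ R : K³` through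
the trace ideal, and concludes by duality. -/

/-! ### Lengths of quotients of submodules. -/

section RelativeLength

variable {A : Type*} [CommRing A] {V W : Type*} [AddCommGroup V] [Module A V] [AddCommGroup W]
  [Module A W]

/-- The length of `Y / (X ∩ Y)` for submodules `X`, `Y` of a module. -/
noncomputable def relLength (X Y : Submodule A V) : ℕ∞ :=
  Module.length A (Y ⧸ X.submoduleOf Y)

theorem relLength_add {X Y Z : Submodule A V} (h : X ≤ Y) (h' : Y ≤ Z) :
    relLength X Z = relLength X Y + relLength Y Z := by
  let f : (Y ⧸ X.submoduleOf Y) →ₗ[A] (Z ⧸ X.submoduleOf Z) :=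
    Submodule.mapQ _ _ (Submodule.inclusion h') (fun y hy => hy)
  let g : (Z ⧸ X.submoduleOf Z) →ₗ[A] (Z ⧸ Y.submoduleOf Z) :=
    Submodule.mapQ _ _ LinearMap.id (fun z hz => h hz)
  refine Module.length_eq_add_of_exact f g ?_ ?_ ?_
  · rw [← LinearMap.ker_eq_bot, LinearMap.ker_eq_bot']
    intro m hm
    obtain ⟨y, rfl⟩ := Submodule.Quotient.mk_surjective _ m
    replace hm := (Submodule.Quotient.mk_eq_zero _).1 hm
    exact (Submodule.Quotient.mk_eq_zero _).2 hm
  · intro m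
    obtain ⟨z, rfl⟩ := Submodule.Quotient.mk_surjective _ m
    exact ⟨Submodule.Quotient.mk z, rfl⟩
  · intro m
    obtain ⟨z, rfl⟩ := Submodule.Quotient.mk_surjective _ m
    constructor
    · intro hz
      replace hz := (Submodule.Quotient.mk_eq_zero _).1 hz
      exact ⟨Submodule.Quotient.mk ⟨z, hz⟩, rfl⟩
    · rintro ⟨y, hy⟩
      obtain ⟨y, rfl⟩ := Submodule.Quotient.mk_surjective _ y
      rw [← hy]
      exact (Submodule.Quotient.mk_eq_zero _).2 y.2

theorem relLength_map (f : V →ₗ[A] W) (hf : Function.Injective f) (X Y : Submodule A V) :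
    relLength (X.map f) (Y.map f) = relLength X Y := by
  refine (LinearEquiv.length_eq (Submodule.Quotient.equiv _ _
    (Submodule.equivMapOfInjective f hf Y) ?_)).symm
  ext ⟨w, hw⟩
  obtain ⟨y, hy, rfl⟩ := hw
  simp only [Submodule.mem_map, Submodule.submoduleOf, Submodule.mem_comap]
  constructor
  · rintro ⟨y', hy', e⟩
    have := congrArg Subtype.val e
    exact ⟨y', hy', this⟩
  · rintro ⟨x, hx, e⟩
    have e : f x = f y := e
    obtain rfl := hf e
    exact ⟨⟨x, hy⟩, hx, rfl⟩

theorem relLength_eq_zero_iff {X Y : Submodule A V} : relLength X Y = 0 ↔ Y ≤ X := by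
  rw [relLength, Module.length_eq_zero_iff, Submodule.Quotient.subsingleton_iff,
    Submodule.submoduleOf_eq_top]

theorem one_le_relLength {X Y : Submodule A V} (h : ¬ Y ≤ X) : 1 ≤ relLength X Y :=
  Order.one_le_iff_pos.2 (pos_iff_ne_zero.2 fun e => h (relLength_eq_zero_iff.1 e))

theorem eq_of_relLength_eq {X Y Z : Submodule A V} (h : X ≤ Y) (h' : Y ≤ Z)
    (ht : relLength X Z ≠ ⊤) (e : relLength X Z ≤ relLength X Y) : Y = Z := by
  refine le_antisymm h' (relLength_eq_zero_iff.1 ?_)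
  rw [relLength_add h h'] at e ht
  have h1 : relLength X Y ≠ ⊤ := fun h => ht (by rw [h, top_add])
  have h2 : relLength Y Z ≠ ⊤ := fun h => ht (by rw [h, add_top])
  lift relLength X Y to ℕ using h1 with a
  lift relLength Y Z to ℕ using h2 with b
  norm_cast at *
  omega

theorem eq_of_relLength_le {X Y Z : Submodule A V} (h : X ≤ Y) (h' : Y ≤ Z)
    (ht : relLength X Z ≠ ⊤) (e : relLength X Z ≤ relLength Y Z) : X = Y := by
  refine le_antisymm h (relLength_eq_zero_iff.1 ?_)
  rw [relLength_add h h'] at e ht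
  have h1 : relLength X Y ≠ ⊤ := fun h => ht (by rw [h, top_add])
  have h2 : relLength Y Z ≠ ⊤ := fun h => ht (by rw [h, add_top])
  lift relLength X Y to ℕ using h1 with a
  lift relLength Y Z to ℕ using h2 with b
  norm_cast at *
  omega

theorem eq_of_relLength_eq_one {X Y Z : Submodule A V} (h : X ≤ Y) (h' : Y ≤ Z)
    (e : relLength X Z = 1) (hne : ¬ Y ≤ X) : Y = Z :=
  eq_of_relLength_eq h h' (by simp [e]) (e ▸ one_le_relLength hne)

theorem relLength_map_mkQ (X Y : Submodule A V) :
    Module.length A (Y.map X.mkQ) = relLength X Y := by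
  refine (LinearEquiv.length_eq ?_).symm
  refine (Submodule.quotEquivOfEq _ _ ?_).trans
    ((X.mkQ.domRestrict Y).quotKerEquivRange.trans (LinearEquiv.ofEq _ _ ?_))
  · ext y
    simp [Submodule.submoduleOf]
  · rw [LinearMap.range_domRestrict]

theorem relLength_top_eq (X : Submodule A V) : relLength X ⊤ = Module.length A (V ⧸ X) := by
  rw [← relLength_map_mkQ, Submodule.map_top, Submodule.range_mkQ, Module.length_top]

theorem relLength_mono {X X' Y Y' : Submodule A V} (h0 : X' ≤ X) (h : X ≤ Y) (h' : Y ≤ Y') :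
    relLength X Y ≤ relLength X' Y' := by
  rw [relLength_add (h0.trans h) h', relLength_add h0 h, add_assoc]
  exact le_add_left le_self_add

end RelativeLength

/-! ### Length of Hom into a module with simple or zero socle. -/

section HomLength

open IsLocalRing

variable {A : Type*} [CommRing A] {E : Type*} [AddCommGroup E] [Module A E]

/-- Left exactness of Hom. The range of restriction replaces `Hom(N, E)`, as homomorphisms need not
extend. -/
theorem length_hom_eq_add {M : Type*} [AddCommGroup M] [Module A M] (N : Submodule A M) :
    Module.length A (M →ₗ[A] E) =
      Module.length A ((M ⧸ N) →ₗ[A] E) +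
        Module.length A (LinearMap.lcomp A E N.subtype).range := by
  refine Module.length_eq_add_of_exact (LinearMap.lcomp A E N.mkQ)
    (LinearMap.lcomp A E N.subtype).rangeRestrict ?_ (LinearMap.surjective_rangeRestrict _) ?_
  · intro a b h
    ext x
    exact LinearMap.congr_fun h x
  · intro φ
    rw [← LinearMap.mem_ker, LinearMap.ker_rangeRestrict, LinearMap.mem_ker]
    constructor
    · intro h
      refine ⟨N.liftQ φ fun x hx => LinearMap.congr_fun h ⟨x, hx⟩, ?_⟩
      ext x
      rfl
    · rintro ⟨ψ, rfl⟩
      ext x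
      simp [(Submodule.Quotient.mk_eq_zero N).2 x.2]

variable [IsLocalRing A]

theorem length_hom_residueField_le (hE : Module.length A (ResidueField A →ₗ[A] E) ≤ 1)
    {S : Type*} [AddCommGroup S] [Module A S] [IsSimpleModule A S] :
    Module.length A (S →ₗ[A] E) ≤ 1 := by
  obtain ⟨m, hm, ⟨e⟩⟩ := isSimpleModule_iff_quot_maximal.mp (inferInstance : IsSimpleModule A S)
  rw [eq_maximalIdeal hm] at e
  exact (LinearEquiv.length_eq (e.congrLeft (M := E) (R := A) (S := A))).trans_le hE

/-- If the socle of `E` has length at most one, then `Hom(-, E)` does not increase length. -/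
theorem length_hom_le (hE : Module.length A (ResidueField A →ₗ[A] E) ≤ 1)
    (M : Type*) [AddCommGroup M] [Module A M] :
    Module.length A (M →ₗ[A] E) ≤ Module.length A M := by
  by_cases hM : IsFiniteLength A M
  · induction hM with
    | of_subsingleton => simp
    | @of_simple_quotient M _ _ N _ _ ih =>
      rw [Module.length_eq_add_of_exact N.subtype N.mkQ N.subtype_injective N.mkQ_surjective
        (LinearMap.exact_subtype_mkQ N), Module.length_eq_one A (M ⧸ N), add_comm]
      rw [length_hom_eq_add N]
      refine add_le_add ?_
        ((Module.length_le_of_injective _ (Submodule.subtype_injective _)).trans ih)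
      exact length_hom_residueField_le hE
  · rw [← Module.length_ne_top_iff, not_ne_iff] at hM
    rw [hM]
    exact le_top

/-- The equality case of `length_hom_le` passes to submodules: if `Hom(M, E)` has the same finite
length as `M`, then every homomorphism from a submodule of `M` to `E` extends to `M`. -/
theorem exists_extend_of_length_hom_eq (hE : Module.length A (ResidueField A →ₗ[A] E) ≤ 1)
    {M : Type*} [AddCommGroup M] [Module A M] (hM : Module.length A M ≠ ⊤)
    (h : Module.length A M ≤ Module.length A (M →ₗ[A] E)) (N : Submodule A M) (φ : N →ₗ[A] E) :
    ∃ ψ : M →ₗ[A] E, ψ ∘ₗ N.subtype = φ := by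
  let g : (M →ₗ[A] E) →ₗ[A] (N →ₗ[A] E) := LinearMap.lcomp A E N.subtype
  have h1 : _ = _ + Module.length A g.range := length_hom_eq_add (E := E) N
  have h2 := Module.length_eq_add_of_exact N.subtype N.mkQ N.subtype_injective N.mkQ_surjective
        (LinearMap.exact_subtype_mkQ N)
  have h3 := length_hom_le hE (M ⧸ N)
  have h4 := length_hom_le hE N
  have h5 := Module.length_eq_add_of_exact g.range.subtype g.range.mkQ g.range.subtype_injective
    g.range.mkQ_surjective (LinearMap.exact_subtype_mkQ _)
  -- `ℓ(M) ≤ ℓ(Hom(M, E)) = ℓ(Hom(M/N, E)) + ℓ(range) ≤ ℓ(M/N) + ℓ(N) = ℓ(M)`, all finite, so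
  -- restriction to `N` has zero cokernel.
  have h6 : Module.length A ((N →ₗ[A] E) ⧸ g.range) = 0 := by
    rw [h1, h2] at h
    rw [h5] at h4
    rw [h2] at hM
    generalize Module.length A ((N →ₗ[A] E) ⧸ g.range) = c at *
    generalize Module.length A g.range = d at *
    generalize Module.length A (M ⧸ N →ₗ[A] E) = a at *
    generalize Module.length A (M ⧸ N) = a' at *
    generalize Module.length A N = b at *
    have hb : b ≠ ⊤ := fun h => hM (by rw [h, top_add])
    have ha : a' ≠ ⊤ := fun h => hM (by rw [h, add_top])
    lift b to ℕ using hb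
    lift a' to ℕ using ha
    lift a to ℕ using ne_top_of_le_ne_top (ENat.natCast_ne_top _) h3
    have h7 := ne_top_of_le_ne_top (ENat.natCast_ne_top _) h4
    have hc : c ≠ ⊤ := fun h => h7 (by rw [h, add_top])
    have hd : d ≠ ⊤ := fun h => h7 (by rw [h, top_add])
    lift c to ℕ using hc
    lift d to ℕ using hd
    norm_cast at *
    omega
  rw [Module.length_eq_zero_iff, Submodule.Quotient.subsingleton_iff] at h6
  have : φ ∈ g.range := h6 ▸ Submodule.mem_top
  obtain ⟨ψ, hψ⟩ := this
  exact ⟨ψ, hψ⟩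

end HomLength

/-! ### Colons and unit multiples of fractional ideals. -/

section Colon

variable {A : Type*} [CommRing A] {Q : Type*} [CommRing Q] [Algebra A Q]

namespace Submodule

theorem div_div_eq_div_mul' (X Y Z : Submodule A Q) : X / Y / Z = X / (Y * Z) := by
  refine le_antisymm ?_ ?_
  · rw [le_div_iff_mul_le, mul_comm Y, ← mul_assoc, ← le_div_iff_mul_le, ← le_div_iff_mul_le]
  · rw [le_div_iff_mul_le, le_div_iff_mul_le, mul_assoc, mul_comm Z, ← le_div_iff_mul_le]

theorem div_mul_le (X Y : Submodule A Q) : X / Y * Y ≤ X :=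
  le_div_iff_mul_le.1 le_rfl

theorem mul_le_mul_of_le (X : Submodule A Q) {Y Z : Submodule A Q} (h : Y ≤ Z) : X * Y ≤ X * Z :=
  Submodule.mul_le.2 fun _ hm _ hn => Submodule.mul_mem_mul hm (h hn)

theorem div_anti (X : Submodule A Q) {Y Z : Submodule A Q} (h : Y ≤ Z) : X / Z ≤ X / Y :=
  le_div_iff_mul_le.2 ((mul_le_mul_of_le _ h).trans (div_mul_le X Z))

theorem le_div_div (X Y : Submodule A Q) : Y ≤ X / (X / Y) :=
  by rw [le_div_iff_mul_le, mul_comm]; exact div_mul_le X Y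

theorem div_one' (X : Submodule A Q) : X / 1 = X :=
  le_antisymm ((mul_one (X / 1)).symm.le.trans (div_mul_le X 1))
    (le_div_iff_mul_le.2 (mul_one X).le)

theorem span_unit_mul_span_inv (u : Qˣ) :
    span A {(u : Q)} * span A {((u⁻¹ : Qˣ) : Q)} = 1 := by
  rw [span_mul_span, Set.singleton_mul_singleton, Units.mul_inv, one_eq_span]

theorem span_inv_mul_span_unit (u : Qˣ) :
    span A {((u⁻¹ : Qˣ) : Q)} * span A {(u : Q)} = 1 := by
  rw [mul_comm, span_unit_mul_span_inv]

theorem span_unit_mul_cancel (u : Qˣ) (X : Submodule A Q) :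
    span A {(u : Q)} * (span A {((u⁻¹ : Qˣ) : Q)} * X) = X := by
  rw [← mul_assoc, span_unit_mul_span_inv, one_mul]

theorem span_inv_mul_cancel (u : Qˣ) (X : Submodule A Q) :
    span A {((u⁻¹ : Qˣ) : Q)} * (span A {(u : Q)} * X) = X := by
  rw [← mul_assoc, span_inv_mul_span_unit, one_mul]

theorem span_unit_mul_le_iff (u : Qˣ) (X Y : Submodule A Q) :
    span A {(u : Q)} * X ≤ Y ↔ X ≤ span A {((u⁻¹ : Qˣ) : Q)} * Y :=
  ⟨fun h => span_inv_mul_cancel u X ▸ mul_le_mul_of_le _ h,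
    fun h => span_unit_mul_cancel u Y ▸ mul_le_mul_of_le _ h⟩

theorem div_span_unit_mul (u : Qˣ) (X Y : Submodule A Q) :
    X / (span A {(u : Q)} * Y) = span A {((u⁻¹ : Qˣ) : Q)} * (X / Y) := by
  refine le_antisymm ?_ ?_
  · rw [← span_unit_mul_le_iff, le_div_iff_mul_le, mul_assoc, mul_left_comm]
    exact div_mul_le _ _
  · rw [le_div_iff_mul_le, mul_mul_mul_comm, span_inv_mul_span_unit, one_mul]
    exact div_mul_le _ _

theorem span_unit_mul_div (u : Qˣ) (X Y : Submodule A Q) :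
    (span A {(u : Q)} * X) / Y = span A {(u : Q)} * (X / Y) := by
  refine le_antisymm ?_ ?_
  · have := span_unit_mul_le_iff (A := A) u⁻¹ ((span A {(u : Q)} * X) / Y) (X / Y)
    rw [inv_inv] at this
    rw [← this, le_div_iff_mul_le, mul_assoc, span_unit_mul_le_iff, inv_inv]
    exact div_mul_le _ _
  · rw [le_div_iff_mul_le, mul_assoc]
    exact mul_le_mul_of_le _ (div_mul_le _ _)

theorem relLength_span_unit_mul (u : Qˣ) (X Y : Submodule A Q) :
    relLength (span A {(u : Q)} * X) (span A {(u : Q)} * Y) = relLength X Y := by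
  have key : ∀ Z : Submodule A Q, span A {(u : Q)} * Z = Z.map (LinearMap.mulLeft A (u : Q)) := by
    intro Z
    ext x
    simp [mem_span_singleton_mul]
  rw [key, key]
  exact relLength_map _ (fun x y h => u.mul_right_inj.1 h) X Y

end Submodule

end Colon

/-! ### Finite length in dimension at most one. -/

section FiniteLength

variable {A : Type*} [CommRing A] [IsNoetherianRing A] [Ring.KrullDimLE 1 A]

/-- Such a module is a quotient of some `(A/d)^n`, and `A/d` has finite length. -/
theorem Module.length_ne_top_of_smul_eq_zero {M : Type*} [AddCommGroup M] [Module A M]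
    [Module.Finite A M] {d : A} (hd : d ∈ nonZeroDivisors A) (h : ∀ m : M, d • m = 0) :
    Module.length A M ≠ ⊤ := by
  obtain ⟨n, s, hs⟩ := Module.Finite.exists_fin (R := A) (M := M)
  let f : (Fin n → A ⧸ Ideal.span {d}) →ₗ[A] M :=
    ∑ i, ((Ideal.span {d}).liftQ (LinearMap.toSpanSingleton A M (s i)) (by
      rw [Ideal.span, Submodule.span_singleton_le_iff_mem]
      simp [h])) ∘ₗ LinearMap.proj i
  have hf : Function.Surjective f := by
    rw [← LinearMap.range_eq_top, eq_top_iff, ← hs, Submodule.span_le]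
    rintro _ ⟨i, rfl⟩
    refine ⟨Pi.single i (Submodule.Quotient.mk 1), ?_⟩
    simp only [f, LinearMap.sum_apply, LinearMap.comp_apply, LinearMap.proj_apply]
    rw [Finset.sum_eq_single i]
    · rw [Pi.single_eq_same]
      exact (Submodule.liftQ_apply _ _ _).trans (one_smul _ _)
    · intro j _ hj
      simp [Pi.single_eq_of_ne hj]
    · simp
  refine ne_top_of_le_ne_top ?_ (Module.length_le_of_surjective f hf)
  rw [Module.length_pi]
  refine WithTop.mul_ne_top ?_ (Ring.ord_ne_top hd)
  rw [ENat.card_eq_coe_fintype_card]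
  exact ENat.natCast_ne_top _

end FiniteLength

/-! ### Regular fractional ideals and their relative lengths. -/

section Fractional

open IsLocalization IsLocalRing Submodule

variable {A : Type*} [CommRing A] {Q : Type*} [CommRing Q] [Algebra A Q] [IsFractionRing A Q]

theorem exists_span_mul_le {X Y : Submodule A Q} (hY : Y.FG) (hX : ∃ u : Qˣ, (u : Q) ∈ X) :
    ∃ d ∈ nonZeroDivisors A, span A {algebraMap A Q d} * Y ≤ X := by
  obtain ⟨u, hu⟩ := hX
  obtain ⟨s, rfl⟩ := hY
  classical
  obtain ⟨⟨d, hd⟩, h⟩ := exist_integer_multiples_of_finset (nonZeroDivisors A)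
    (s.image fun y => ((u⁻¹ : Qˣ) : Q) * y)
  refine ⟨d, hd, ?_⟩
  rw [span_mul_span, span_le]
  rintro _ ⟨_, rfl, y, hy, rfl⟩
  obtain ⟨r, hr⟩ := h _ (Finset.mem_image_of_mem _ hy)
  simp only [Algebra.smul_def] at hr
  have : algebraMap A Q d * y = r • (u : Q) := by
    rw [Algebra.smul_def, hr]
    calc algebraMap A Q d * y = algebraMap A Q d * (((u⁻¹ : Qˣ) : Q) * u) * y := by simp
      _ = _ := by ring
  change algebraMap A Q d * y ∈ X
  rw [this]
  exact X.smul_mem r hu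

theorem exists_units_algebraMap {d : A} (hd : d ∈ nonZeroDivisors A) :
    ∃ u : Qˣ, (u : Q) = algebraMap A Q d :=
  IsLocalization.map_units Q (⟨d, hd⟩ : nonZeroDivisors A)

theorem exists_unit_mem_div {X Y : Submodule A Q} (hY : Y.FG) (hX : ∃ u : Qˣ, (u : Q) ∈ X) :
    ∃ u : Qˣ, (u : Q) ∈ X / Y := by
  obtain ⟨d, hd, h⟩ := exists_span_mul_le hY hX
  obtain ⟨u, hu⟩ := exists_units_algebraMap (Q := Q) hd
  refine ⟨u, ?_⟩
  rw [← span_singleton_le_iff_mem, Submodule.le_div_iff_mul_le, hu]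
  exact h

omit [IsFractionRing A Q] in
theorem fg_one : (1 : Submodule A Q).FG :=
  Submodule.one_eq_span (R := A) (A := Q) ▸ fg_span_singleton 1

omit [IsFractionRing A Q] in
theorem exists_unit_mem_one : ∃ u : Qˣ, (u : Q) ∈ (1 : Submodule A Q) :=
  ⟨1, Submodule.one_le.1 (le_refl (1 : Submodule A Q))⟩

variable [IsNoetherianRing A]

omit [IsFractionRing A Q] in
theorem Submodule.FG.of_le' {X Y : Submodule A Q} (hY : Y.FG) (h : X ≤ Y) : X.FG := by
  have := isNoetherian_of_fg_of_noetherian Y hY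
  obtain ⟨Z, rfl⟩ : ∃ Z : Submodule A Y, Z.map Y.subtype = X :=
    ⟨X.submoduleOf Y, by simpa [Submodule.submoduleOf, Submodule.map_comap_subtype] using h⟩
  exact (IsNoetherian.noetherian Z).map _

omit [IsFractionRing A Q] in
-- A unit `u ∈ Y` confines `X : Y` to the finitely generated module `u⁻¹X`.
theorem fg_div {X Y : Submodule A Q} (hX : X.FG) (hY : ∃ u : Qˣ, (u : Q) ∈ Y) : (X / Y).FG := by
  obtain ⟨u, hu⟩ := hY
  refine Submodule.FG.of_le' ((fg_span_singleton ((u⁻¹ : Qˣ) : Q)).mul hX) ?_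
  rw [← span_unit_mul_le_iff, mul_comm]
  exact (mul_le_mul_of_le _ ((span_singleton_le_iff_mem _ _).2 hu)).trans (div_mul_le _ _)

variable [Ring.KrullDimLE 1 A]

theorem relLength_ne_top {X Y : Submodule A Q} (hY : Y.FG) (hX : ∃ u : Qˣ, (u : Q) ∈ X) :
    relLength X Y ≠ ⊤ := by
  obtain ⟨d, hd, h⟩ := exists_span_mul_le hY hX
  have : Module.Finite A Y := Module.Finite.iff_fg.2 hY
  refine Module.length_ne_top_of_smul_eq_zero hd fun m => ?_
  obtain ⟨y, rfl⟩ := Submodule.Quotient.mk_surjective _ m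
  rw [← Submodule.Quotient.mk_smul, Submodule.Quotient.mk_eq_zero]
  refine h ?_
  rw [mem_span_singleton_mul]
  exact ⟨y, y.2, by simp [Algebra.smul_def]⟩

/-- Compute the length of `Y/dX` through `X` and through `dY`, and cancel the finite length `ℓ(Y/X)
= ℓ(dY/dX)`. -/
theorem relLength_span_mul_self_eq_of_le {X Y : Submodule A Q} (h : X ≤ Y) (hY : Y.FG)
    (hX : ∃ u : Qˣ, (u : Q) ∈ X) {d : A} (hd : d ∈ nonZeroDivisors A) :
    relLength (span A {algebraMap A Q d} * X) X = relLength (span A {algebraMap A Q d} * Y) Y := by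
  obtain ⟨u, hu⟩ := exists_units_algebraMap (Q := Q) hd
  have hle : ∀ Z : Submodule A Q, span A {(u : Q)} * Z ≤ Z := by
    intro Z x hx
    obtain ⟨z, hz, rfl⟩ := mem_span_singleton_mul.1 hx
    rw [hu, ← Algebra.smul_def]
    exact Z.smul_mem d hz
  rw [← hu]
  have h1 := relLength_add (hle X) h
  have h2 := relLength_add (Submodule.mul_le_mul_of_le (span A {(u : Q)}) h) (hle Y)
  rw [relLength_span_unit_mul] at h2
  rw [h1, add_comm] at h2
  exact (WithTop.add_left_inj (relLength_ne_top hY hX)).1 h2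

theorem relLength_span_mul_self {X Y : Submodule A Q} (hX : X.FG)
    (hX' : ∃ u : Qˣ, (u : Q) ∈ X) (hY : Y.FG) (hY' : ∃ u : Qˣ, (u : Q) ∈ Y)
    {d : A} (hd : d ∈ nonZeroDivisors A) :
    relLength (span A {algebraMap A Q d} * X) X = relLength (span A {algebraMap A Q d} * Y) Y :=
  (relLength_span_mul_self_eq_of_le le_sup_left (hX.sup hY) hX' hd).trans
    (relLength_span_mul_self_eq_of_le le_sup_right (hX.sup hY) hY' hd).symm

theorem relLength_span_mul_self_eq {X : Submodule A Q} (hX : X.FG)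
    (hX' : ∃ u : Qˣ, (u : Q) ∈ X) {d : A} (hd : d ∈ nonZeroDivisors A) :
    relLength (span A {algebraMap A Q d} * X) X = Module.length A (A ⧸ Ideal.span {d}) := by
  rw [relLength_span_mul_self hX hX' fg_one exists_unit_mem_one hd, mul_one,
    ← relLength_top_eq, ← relLength_map (Algebra.linearMap A Q) (IsFractionRing.injective A Q),
    Submodule.map_top, ← Submodule.one_eq_range]
  congr 1
  exact (coeSubmodule_span_singleton Q d).symm

end Fractional

/-! ### Duality with respect to a dualizing fractional ideal. -/

section Duality

open IsLocalization IsLocalRing Submodule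

variable {A : Type*} [CommRing A] {Q : Type*} [CommRing Q] [Algebra A Q]

theorem coeSubmodule_le_one (I : Ideal A) : coeSubmodule Q I ≤ 1 :=
  (coeSubmodule_mono Q le_top).trans (coeSubmodule_top Q).le

theorem le_div_coeSubmodule (K : Submodule A Q) (I : Ideal A) : K ≤ K / coeSubmodule Q I := by
  rw [Submodule.le_div_iff_mul_le]
  exact (mul_le_mul_of_le _ (coeSubmodule_le_one I)).trans (mul_one K).le

variable [IsLocalRing A]

/-- The ideal-theoretic form of a canonical module: a finitely generated fractional ideal `K`
containing a unit, such that `(K : 𝔪) / K` has length one. -/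
structure IsDualizing (K : Submodule A Q) : Prop where
  fg : K.FG
  exists_unit : ∃ u : Qˣ, (u : Q) ∈ K
  relLength_socle : relLength K (K / coeSubmodule Q (maximalIdeal A)) = 1

theorem IsDualizing.span_unit_mul {K : Submodule A Q} (hK : IsDualizing K) (u : Qˣ) :
    IsDualizing (span A {(u : Q)} * K) where
  fg := (fg_span_singleton _).mul hK.fg
  exists_unit := by
    obtain ⟨v, hv⟩ := hK.exists_unit
    exact ⟨u * v, mul_mem_mul (mem_span_singleton_self _) hv⟩
  relLength_socle := by
    rw [span_unit_mul_div, relLength_span_unit_mul, hK.relLength_socle]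

/-- A homomorphism from the residue field is determined by the image of `1`, which is killed by `𝔪`
and so lies in `(K : 𝔪)/K`. -/
theorem length_hom_residueField_quotient_le {K : Submodule A Q} :
    Module.length A (ResidueField A →ₗ[A] Q ⧸ K) ≤
      relLength K (K / coeSubmodule Q (maximalIdeal A)) := by
  rw [← relLength_map_mkQ]
  let f : (ResidueField A →ₗ[A] Q ⧸ K) →ₗ[A] Q ⧸ K := LinearMap.applyₗ (residue A 1)
  have hf : ∀ φ, f φ ∈ (K / coeSubmodule Q (maximalIdeal A)).map K.mkQ := by
    intro φ
    obtain ⟨q, hq⟩ := K.mkQ_surjective (f φ)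
    rw [← hq]
    refine mem_map_of_mem (Submodule.mem_div_iff_forall_mul_mem.2 ?_)
    rintro _ ⟨r, hr, rfl⟩
    rw [← Submodule.Quotient.mk_eq_zero]
    have h1 : (Submodule.Quotient.mk (q * Algebra.linearMap A Q r) : Q ⧸ K) = r • K.mkQ q := by
      rw [Submodule.mkQ_apply, ← Submodule.Quotient.mk_smul, Algebra.smul_def, mul_comm]
      rfl
    rw [h1, hq]
    change r • φ (residue A 1) = 0
    rw [← map_smul, Algebra.smul_def, map_one, mul_one]
    have : algebraMap A (ResidueField A) r = 0 := (residue_eq_zero_iff r).2 hr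
    rw [this, map_zero]
  refine Module.length_le_of_injective (f.codRestrict _ hf) ?_
  intro φ ψ h
  have h : φ (residue A 1) = ψ (residue A 1) := congrArg Subtype.val h
  ext x
  obtain ⟨a, rfl⟩ := residue_surjective x
  have : residue A a = a • residue A 1 := by
    rw [Algebra.smul_def, map_one, mul_one]
    rfl
  rw [this, map_smul, map_smul, h]

/-- Multiplication embeds `(K : X)/(K : Y)` into `Hom(Y/(X ∩ Y), Q/K)`, and the socle of `Q/K` has
length at most one. -/
theorem relLength_div_le {K : Submodule A Q}
    (hK : relLength K (K / coeSubmodule Q (maximalIdeal A)) ≤ 1) (X Y : Submodule A Q) :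
    relLength (K / Y) (K / X) ≤ relLength X Y := by
  refine le_trans ?_ (length_hom_le (length_hom_residueField_quotient_le.trans hK)
    (Y ⧸ X.submoduleOf Y))
  let g : (K / X : Submodule A Q) →ₗ[A] (Y ⧸ X.submoduleOf Y) →ₗ[A] Q ⧸ K :=
    { toFun := fun q => (X.submoduleOf Y).liftQ
        (K.mkQ ∘ₗ LinearMap.mulLeft A (q : Q) ∘ₗ Y.subtype) (by
          intro x hx
          exact (Submodule.Quotient.mk_eq_zero _).2
            (Submodule.mem_div_iff_forall_mul_mem.1 q.2 x hx))
      map_add' := fun p q => by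
        ext y
        exact congrArg K.mkQ (add_mul (p : Q) q y)
      map_smul' := fun r q => by
        ext y
        exact congrArg K.mkQ (smul_mul_assoc r (q : Q) (y : Q)) }
  have hg : ∀ (q : (K / X : Submodule A Q)) (y : Y),
      g q (Submodule.Quotient.mk y) = Submodule.Quotient.mk ((q : Q) * y) := fun q y => rfl
  refine Module.length_le_of_injective (((K / Y).submoduleOf (K / X)).liftQ g ?_) ?_
  · intro q hq
    rw [LinearMap.mem_ker]
    ext y
    exact (Submodule.Quotient.mk_eq_zero _).2 (Submodule.mem_div_iff_forall_mul_mem.1 hq y y.2)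
  · rw [← LinearMap.ker_eq_bot, LinearMap.ker_eq_bot']
    intro m hm
    obtain ⟨q, rfl⟩ := Submodule.Quotient.mk_surjective _ m
    refine (Submodule.Quotient.mk_eq_zero _).2 (Submodule.mem_div_iff_forall_mul_mem.2 ?_)
    intro y hy
    have := LinearMap.congr_fun hm (Submodule.Quotient.mk ⟨y, hy⟩)
    rw [Submodule.liftQ_apply, hg] at this
    exact (Submodule.Quotient.mk_eq_zero _).1 this

omit [IsLocalRing A] in
theorem isMaximal_of_mem_nonZeroDivisors [Ring.KrullDimLE 1 A] {d : A} (hd : d ∈ nonZeroDivisors A)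
    {p : Ideal A} (hp : p.IsPrime) (h : d ∈ p) : p.IsMaximal :=
  (Ring.krullDimLE_one_iff.1 inferInstance p hp).resolve_left fun hmin =>
    (Ideal.disjoint_nonZeroDivisors_of_mem_minimalPrimes hmin).le_bot ⟨h, hd⟩

theorem radical_span_singleton_eq_maximalIdeal [Ring.KrullDimLE 1 A] {d : A}
    (hd : d ∈ nonZeroDivisors A) (hdm : d ∈ maximalIdeal A) :
    (Ideal.span {d}).radical = maximalIdeal A := by
  refine le_antisymm ?_ ?_
  · exact (maximalIdeal.isMaximal A).isPrime.radical_le_iff.2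
      ((Ideal.span_singleton_le_iff_mem _).2 hdm)
  · rw [Ideal.radical_eq_sInf]
    refine le_sInf fun p ⟨hp, hp'⟩ => ?_
    exact (eq_maximalIdeal (isMaximal_of_mem_nonZeroDivisors hd hp'
      (hp (Ideal.mem_span_singleton_self d)))).ge

theorem exists_maximalIdeal_pow_le_span [IsNoetherianRing A] [Ring.KrullDimLE 1 A] {d : A}
    (hd : d ∈ nonZeroDivisors A) : ∃ i, maximalIdeal A ^ i ≤ Ideal.span {d} := by
  by_cases hu : IsUnit d
  · exact ⟨0, by simp [Ideal.span_singleton_eq_top.2 hu]⟩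
  · exact Ideal.exists_pow_le_of_le_radical_of_fg
      (radical_span_singleton_eq_maximalIdeal hd hu).ge (IsNoetherian.noetherian _)

variable [IsFractionRing A Q] [IsNoetherianRing A] [Ring.KrullDimLE 1 A]

/-- Duality with respect to a dualizing fractional ideal preserves relative lengths. -/
theorem IsDualizing.relLength_div {K X Y : Submodule A Q} (hK : IsDualizing K) (h : X ≤ Y)
    (hX : ∃ u : Qˣ, (u : Q) ∈ X) (hY : Y.FG) :
    relLength (K / Y) (K / X) = relLength X Y := by
  have hY' : ∃ u : Qˣ, (u : Q) ∈ Y := hX.imp fun _ hu => h hu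
  obtain ⟨d, hd, hle⟩ := exists_span_mul_le hY hX
  have e1 := relLength_span_mul_self_eq hY hY' hd
  have e2 := relLength_span_mul_self_eq (fg_div hK.fg hY')
    (exists_unit_mem_div hY hK.exists_unit) hd
  obtain ⟨u, hu⟩ := exists_units_algebraMap (Q := Q) hd
  rw [← hu] at hle e1 e2
  -- For `dY ⊆ X ⊆ Y`, dualizing preserves the total length `ℓ(Y/dY)`. It increases neither of the
  -- two partial lengths, so it preserves both.
  have e3 : relLength (K / Y) (K / (span A {(u : Q)} * Y)) =
      relLength (span A {(u : Q)} * Y) Y := by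
    rw [div_span_unit_mul, e1, ← e2, ← relLength_span_unit_mul u (K / Y), span_unit_mul_cancel]
  rw [relLength_add (K.div_anti h) (K.div_anti hle), relLength_add hle h, add_comm] at e3
  have h1 := relLength_div_le hK.relLength_socle.le X Y
  have h2 := relLength_div_le hK.relLength_socle.le (span A {(u : Q)} * Y) X
  have ht : relLength (span A {(u : Q)} * Y) X ≠ ⊤ := by
    refine ne_top_of_le_ne_top (b := relLength (span A {(u : Q)} * Y) Y) ?_ ?_
    · rw [e1]
      exact Ring.ord_ne_top hd
    · rw [relLength_add hle h]
      exact le_self_add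
  have ht' := relLength_ne_top hY hX
  generalize relLength (K / Y) (K / X) = a at *
  generalize relLength X Y = b at *
  generalize relLength (span A {(u : Q)} * Y) X = c at *
  generalize relLength (K / X) (K / (span A {(u : Q)} * Y)) = d at *
  lift c to ℕ using ht
  lift b to ℕ using ht'
  lift a to ℕ using ne_top_of_le_ne_top (ENat.natCast_ne_top _) h1
  lift d to ℕ using ne_top_of_le_ne_top (ENat.natCast_ne_top _) h2
  norm_cast at *
  omega

theorem IsDualizing.eq_of_div_eq {K X Y : Submodule A Q} (hK : IsDualizing K) (h : X ≤ Y)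
    (hX : ∃ u : Qˣ, (u : Q) ∈ X) (hY : Y.FG) (e : K / X ≤ K / Y) : X = Y := by
  refine le_antisymm h (relLength_eq_zero_iff.1 ?_)
  rw [← hK.relLength_div h hX hY, relLength_eq_zero_iff]
  exact e

/-- `X` and the larger module `K : (K : X)` have the same dual, and duality detects proper
inclusions. -/
theorem IsDualizing.div_div {K X : Submodule A Q} (hK : IsDualizing K)
    (hX : ∃ u : Qˣ, (u : Q) ∈ X) (hX' : X.FG) : K / (K / X) = X := by
  refine (hK.eq_of_div_eq (le_div_div K X) hX
    (fg_div hK.fg (exists_unit_mem_div hX' hK.exists_unit)) ?_).symm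
  exact le_div_div K (K / X)

theorem IsDualizing.div_self {K : Submodule A Q} (hK : IsDualizing K) : K / K = 1 := by
  have := hK.div_div exists_unit_mem_one fg_one
  rwa [div_one'] at this

/-- Every fractional ideal properly containing a dualizing one contains its socle extension. -/
theorem IsDualizing.div_maximalIdeal_le {K Y : Submodule A Q} (hK : IsDualizing K) (h : K ≤ Y)
    (hY : Y.FG) (hne : ¬ Y ≤ K) : K / coeSubmodule Q (maximalIdeal A) ≤ Y := by
  let m := coeSubmodule Q (maximalIdeal A)
  obtain ⟨d, hd, hle⟩ := exists_span_mul_le hY hK.exists_unit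
  have key : ∃ i, m ^ i * Y ≤ K := by
    obtain ⟨i, hi⟩ := exists_maximalIdeal_pow_le_span hd
    refine ⟨i, ?_⟩
    have : m ^ i ≤ span A {algebraMap A Q d} := by
      rw [← coeSubmodule_span_singleton Q d]
      refine le_trans (le_of_eq ?_) (coeSubmodule_mono Q hi)
      clear hi hle
      induction i with
      | zero => simp [coeSubmodule_top]
      | succ i ih => rw [pow_succ, pow_succ, ih, coeSubmodule_mul]
    rw [mul_comm] at hle ⊢
    exact (mul_le_mul_of_le _ this).trans hle
  classical
  -- For the least `i` with `𝔪^i Y ⊆ K`, the module `K + 𝔪^(i-1) Y` lies in `K : 𝔪` and is strictly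
  -- larger than `K`. As `(K : 𝔪)/K` has length one, it is all of `K : 𝔪`.
  let i := Nat.find key
  have hi : m ^ i * Y ≤ K := Nat.find_spec key
  have hi0 : i ≠ 0 := by
    intro h0
    rw [h0, pow_zero, one_mul] at hi
    exact hne hi
  obtain ⟨j, hj⟩ := Nat.exists_eq_succ_of_ne_zero hi0
  have hj' : ¬ m ^ j * Y ≤ K := Nat.find_min key (show j < i by omega)
  have hjY : m ^ j * Y ≤ Y := by
    have : m ^ j ≤ 1 := pow_le_one' (coeSubmodule_le_one _) j
    rw [mul_comm]
    exact (mul_le_mul_of_le _ this).trans (mul_one Y).le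
  have hle1 : K ⊔ m ^ j * Y ≤ K / m := by
    refine sup_le (le_div_coeSubmodule K _) ?_
    rw [Submodule.le_div_iff_mul_le, mul_right_comm, ← pow_succ, ← Nat.succ_eq_add_one, ← hj]
    exact hi
  rw [← eq_of_relLength_eq_one le_sup_left hle1 hK.relLength_socle
    fun h => hj' (le_sup_right.trans h)]
  exact sup_le h hjY

/-- Two dualizing fractional ideals differ by a unit of the total ring of fractions. -/
theorem IsDualizing.exists_eq_span_unit_mul {K L : Submodule A Q} (hK : IsDualizing K)
    (hL : IsDualizing L) (hA : ∃ c ∈ maximalIdeal A, c ∈ nonZeroDivisors A) :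
    ∃ u : Qˣ, L = span A {(u : Q)} * K := by
  let m := coeSubmodule Q (maximalIdeal A)
  let X := K / L
  have hX : X.FG := fg_div hK.fg hL.exists_unit
  have hXu : ∃ u : Qˣ, (u : Q) ∈ X := exists_unit_mem_div hL.fg hK.exists_unit
  have hKX : K / X = L := hK.div_div hL.exists_unit hL.fg
  have hmX : m * X ≤ X := by
    rw [mul_comm]
    exact (mul_le_mul_of_le _ (coeSubmodule_le_one _)).trans (mul_one X).le
  have hmu : ∃ u : Qˣ, (u : Q) ∈ m * X := by
    obtain ⟨c, hc, hc'⟩ := hA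
    obtain ⟨u, hu⟩ := exists_units_algebraMap (Q := Q) hc'
    obtain ⟨v, hv⟩ := hXu
    exact ⟨u * v, mul_mem_mul ⟨c, hc, hu.symm⟩ hv⟩
  -- The dual of `X/𝔪X` is `(L : 𝔪)/L`, of length one; so `X = K : L` is cyclic by Nakayama, and
  -- dualizing back makes `L` a multiple of `K`.
  have h1 : relLength (m * X) X = 1 := by
    rw [← hK.relLength_div hmX hmu hX, mul_comm, ← div_div_eq_div_mul', hKX, hL.relLength_socle]
  obtain ⟨x, hx, hx'⟩ : ∃ x ∈ X, x ∉ m * X := by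
    by_contra! h
    exact zero_ne_one ((relLength_eq_zero_iff.2 h).symm.trans h1)
  have h2 : m * X ⊔ span A {x} = X := eq_of_relLength_eq_one le_sup_left
    (sup_le hmX ((span_singleton_le_iff_mem _ _).2 hx)) h1
    fun h => hx' (h (le_sup_right (a := m * X) (mem_span_singleton_self x)))
  have h3 : X ≤ span A {x} := by
    refine Submodule.le_of_le_smul_of_le_jacobson_bot hX
      (jacobson_eq_maximalIdeal (⊥ : Ideal A) bot_ne_top).ge ?_
    conv_lhs => rw [← h2]
    rw [sup_comm]
    refine sup_le_sup_left ?_ _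
    refine Submodule.mul_le.2 ?_
    rintro _ ⟨r, hr, rfl⟩ y hy
    rw [Algebra.linearMap_apply, ← Algebra.smul_def]
    exact smul_mem_smul hr hy
  have h4 : X = span A {x} := le_antisymm h3 ((span_singleton_le_iff_mem _ _).2 hx)
  obtain ⟨u, hu⟩ := hXu
  obtain ⟨a, ha⟩ := mem_span_singleton.1 (h3 hu)
  have hxu : IsUnit x := by
    rw [Algebra.smul_def] at ha
    exact isUnit_of_mul_isUnit_right (ha ▸ u.isUnit)
  obtain ⟨v, rfl⟩ := hxu
  refine ⟨v⁻¹, ?_⟩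
  rw [← hKX, h4, ← mul_one (span A {(v : Q)}), div_span_unit_mul, div_one']

end Duality

/-! ### Extending homomorphisms into a dualizing fractional ideal. -/

section Extension

open IsLocalization IsLocalRing Submodule

theorem LinearMap.exists_comp_eq_of_surjective {A : Type*} [CommRing A] {M N P : Type*}
    [AddCommGroup M] [AddCommGroup N] [AddCommGroup P] [Module A M] [Module A N] [Module A P]
    {f : M →ₗ[A] N} (hf : Function.Surjective f) {g : M →ₗ[A] P}
    (h : LinearMap.ker f ≤ LinearMap.ker g) : ∃ g' : N →ₗ[A] P, g' ∘ₗ f = g := by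
  refine ⟨(LinearMap.ker f).liftQ g h ∘ₗ (f.quotKerEquivOfSurjective hf).symm, ?_⟩
  ext x
  have : (f.quotKerEquivOfSurjective hf).symm (f x) = Submodule.Quotient.mk x := by
    rw [LinearEquiv.symm_apply_eq]
    rfl
  rw [LinearMap.comp_apply, LinearMap.comp_apply, LinearEquiv.coe_coe, this]
  rfl

variable {A : Type*} [CommRing A] [IsLocalRing A] [IsNoetherianRing A] [Ring.KrullDimLE 1 A]
  {Q : Type*} [CommRing Q] [Algebra A Q] [IsFractionRing A Q]

/-- The elements of `c⁻¹K/K` are killed by `c`, so they define homomorphisms from `A/c`; and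
`ℓ(c⁻¹K/K) = ℓ(K/cK) = ℓ(A/c)`. -/
theorem IsDualizing.length_le_length_hom {K : Submodule A Q} (hK : IsDualizing K) {c : A}
    (hc : c ∈ nonZeroDivisors A) :
    Module.length A (A ⧸ Ideal.span {c}) ≤ Module.length A ((A ⧸ Ideal.span {c}) →ₗ[A] Q ⧸ K) := by
  obtain ⟨u, hu⟩ := exists_units_algebraMap (Q := Q) hc
  rw [← relLength_span_mul_self_eq hK.fg hK.exists_unit hc, ← hu,
    ← relLength_span_unit_mul u⁻¹, span_inv_mul_cancel, ← relLength_map_mkQ]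
  let g : (Q ⧸ K) →ₗ[A] (A →ₗ[A] Q ⧸ K) := (LinearMap.ringLmapEquivSelf A A (Q ⧸ K)).symm
  have hg : ∀ x ∈ (span A {((u⁻¹ : Qˣ) : Q)} * K).map K.mkQ,
      Ideal.span {c} ≤ LinearMap.ker (g x) := by
    rintro _ ⟨x, hx, rfl⟩
    rw [Ideal.span, span_singleton_le_iff_mem, LinearMap.mem_ker]
    change c • K.mkQ x = 0
    rw [← map_smul, mkQ_apply, Submodule.Quotient.mk_eq_zero, Algebra.smul_def, ← hu]
    obtain ⟨y, hy, rfl⟩ := mem_span_singleton_mul.1 hx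
    simpa using hy
  let G : (span A {((u⁻¹ : Qˣ) : Q)} * K).map K.mkQ →ₗ[A] (A ⧸ Ideal.span {c}) →ₗ[A] Q ⧸ K :=
    { toFun := fun x => (Ideal.span {c}).liftQ (g x) (hg x x.2)
      map_add' := fun x y => by
        apply Submodule.linearMap_qext
        exact map_add g (x : Q ⧸ K) y
      map_smul' := fun r x => by
        apply Submodule.linearMap_qext
        exact map_smul g r (x : Q ⧸ K) }
  refine Module.length_le_of_injective G ?_
  intro x y h
  have := LinearMap.congr_fun h (Submodule.Quotient.mk 1)
  have e : ∀ z, G z (Submodule.Quotient.mk 1) = z := fun z => one_smul A (z : Q ⧸ K)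
  rw [e, e] at this
  exact Subtype.ext this

/-- Homomorphisms into a dualizing fractional ideal extend modulo a nonzerodivisor. -/
theorem IsDualizing.exists_extend_mod {K : Submodule A Q} (hK : IsDualizing K) {c : A}
    (hc : c ∈ nonZeroDivisors A) {n : ℕ} (Z : Submodule A (Fin n → A))
    (hZ : ∀ x, c • x ∈ Z → x ∈ Z) (φ : Z →ₗ[A] K) :
    ∃ (ψ : (Fin n → A) →ₗ[A] K) (θ : Z →ₗ[A] K), φ = ψ ∘ₗ Z.subtype + c • θ := by
  obtain ⟨u, hu⟩ := exists_units_algebraMap (Q := Q) hc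
  have hcu : ∀ q : Q, c • (((u⁻¹ : Qˣ) : Q) * q) = q := fun q => by
    rw [Algebra.smul_def, ← hu, Units.mul_inv_cancel_left]
  let π : (Fin n → A) →ₗ[A] (Fin n → A ⧸ Ideal.span {c}) :=
    LinearMap.pi fun i => (Ideal.span {c}).mkQ ∘ₗ LinearMap.proj i
  have hE := (length_hom_residueField_quotient_le (K := K)).trans hK.relLength_socle.le
  -- Let `μ = φ/c`. Modulo `K` it vanishes on `Z ∩ cAⁿ = cZ`, so it factors through the image of `Z`
  -- in `(A/c)ⁿ`, extends there by the length count, and lifts to `ψ₀ : Aⁿ → Q`. The decomposition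
  -- is then `φ = cψ₀ + c(μ - ψ₀)`.
  let μ : Z →ₗ[A] Q := LinearMap.mulLeft A ((u⁻¹ : Qˣ) : Q) ∘ₗ K.subtype ∘ₗ φ
  let p : Z →ₗ[A] Z.map π := (π.domRestrict Z).codRestrict _ fun z => mem_map_of_mem z.2
  have hp : Function.Surjective p := by
    rintro ⟨_, z, hz, rfl⟩
    exact ⟨⟨z, hz⟩, rfl⟩
  obtain ⟨φ', hφ'⟩ := LinearMap.exists_comp_eq_of_surjective hp (g := K.mkQ ∘ₗ μ) (by
    intro z hz
    have hz : π z = 0 := congrArg Subtype.val (LinearMap.mem_ker.1 hz)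
    have : ∃ x : Fin n → A, c • x = z := by
      have h1 : ∀ i, ∃ a, a * c = (z : Fin n → A) i := fun i => by
        have := congrFun hz i
        exact Ideal.mem_span_singleton'.1 ((Submodule.Quotient.mk_eq_zero _).1 this)
      choose x hx using h1
      exact ⟨x, funext fun i => by rw [Pi.smul_apply, smul_eq_mul, mul_comm, hx]⟩
    obtain ⟨x, hx⟩ := this
    have hxZ : x ∈ Z := hZ x (hx ▸ z.2)
    have hz' : z = c • (⟨x, hxZ⟩ : Z) := Subtype.ext hx.symm
    refine (Submodule.Quotient.mk_eq_zero _).2 ?_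
    rw [hz', map_smul]
    change c • (((u⁻¹ : Qˣ) : Q) * φ ⟨x, hxZ⟩) ∈ K
    rw [hcu]
    exact (φ _).2)
  have hlen : Module.length A (Fin n → A ⧸ Ideal.span {c}) ≤
      Module.length A ((Fin n → A ⧸ Ideal.span {c}) →ₗ[A] Q ⧸ K) := by
    rw [← (LinearMap.lsum A (fun _ : Fin n => A ⧸ Ideal.span {c}) A (M := Q ⧸ K)).length_eq,
      Module.length_pi, Module.length_pi]
    gcongr
    exact hK.length_le_length_hom hc
  have hlen' : Module.length A (Fin n → A ⧸ Ideal.span {c}) ≠ ⊤ := by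
    rw [Module.length_pi]
    exact WithTop.mul_ne_top (by rw [ENat.card_eq_coe_fintype_card]; exact ENat.natCast_ne_top _)
      (Ring.ord_ne_top hc)
  obtain ⟨Ψ, hΨ⟩ := exists_extend_of_length_hom_eq hE hlen' hlen (Z.map π) φ'
  obtain ⟨ψ₀, hψ₀⟩ := Module.projective_lifting_property K.mkQ (Ψ ∘ₗ π) K.mkQ_surjective
  have h1 : ∀ x, c • ψ₀ x ∈ K := by
    intro x
    rw [← Submodule.Quotient.mk_eq_zero, ← mkQ_apply, map_smul]
    have := LinearMap.congr_fun hψ₀ x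
    rw [LinearMap.comp_apply] at this
    rw [this, LinearMap.comp_apply, ← map_smul, ← map_smul]
    have : π (c • x) = 0 := by
      ext i
      refine (Submodule.Quotient.mk_eq_zero _).2 ?_
      exact Ideal.mul_mem_right _ _ (Ideal.mem_span_singleton_self c)
    rw [this, map_zero]
  have h2 : ∀ z, (μ - ψ₀ ∘ₗ Z.subtype) z ∈ K := by
    intro z
    rw [← Submodule.Quotient.mk_eq_zero, ← mkQ_apply, LinearMap.sub_apply, map_sub, sub_eq_zero]
    refine (LinearMap.congr_fun hφ' z).symm.trans ?_
    rw [← hΨ]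
    exact (LinearMap.congr_fun hψ₀ z).symm
  refine ⟨(c • ψ₀).codRestrict K h1, (μ - ψ₀ ∘ₗ Z.subtype).codRestrict K h2, ?_⟩
  ext z
  change (φ z : Q) = c • ψ₀ z + c • (((u⁻¹ : Qˣ) : Q) * φ z - ψ₀ z)
  rw [smul_sub, hcu]
  abel

/-- Extension modulo `c` says that restrictions from `Aⁿ` together with `𝔪 Hom(Z, K)` fill `Hom(Z,
K)`; Nakayama removes the second term. -/
theorem IsDualizing.exists_extend {K : Submodule A Q} (hK : IsDualizing K) {c : A}
    (hc : c ∈ nonZeroDivisors A) (hcm : c ∈ maximalIdeal A) {n : ℕ} (Z : Submodule A (Fin n → A))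
    (hZ : ∀ x, c • x ∈ Z → x ∈ Z) (φ : Z →ₗ[A] K) :
    ∃ ψ : (Fin n → A) →ₗ[A] K, ψ ∘ₗ Z.subtype = φ := by
  have : Module.Finite A K := Module.Finite.iff_fg.2 hK.fg
  have : (⊤ : Submodule A (Z →ₗ[A] K)) ≤ (LinearMap.lcomp A K Z.subtype).range := by
    have hfg : (⊤ : Submodule A (Z →ₗ[A] K)).FG := Module.Finite.fg_top
    refine Submodule.le_of_le_smul_of_le_jacobson_bot (M := Z →ₗ[A] K) hfg
        (jacobson_eq_maximalIdeal (⊥ : Ideal A) bot_ne_top).ge ?_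
    intro φ _
    obtain ⟨ψ, θ, rfl⟩ := hK.exists_extend_mod hc Z hZ φ
    exact add_mem_sup ⟨ψ, rfl⟩ (smul_mem_smul hcm mem_top)
  exact this (mem_top (x := φ))

end Extension

/-! ### Canonical modules in terms of dualizing fractional ideals. -/

section Ext

open IsLocalization IsLocalRing Submodule CategoryTheory Abelian

variable {A : Type u} [CommRing A]

variable [IsLocalRing A]

variable [IsNoetherianRing A] [Ring.KrullDimLE 1 A]
  {Q : Type*} [CommRing Q] [Algebra A Q] [IsFractionRing A Q]

/-- Dimension shifting along `0 → ker f → Aⁿ → Y → 0`. The kernel is saturated for `c` because `Y`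
is `c`-torsion-free, so homomorphisms from it extend and `Ext¹` vanishes; being inside `Aⁿ`, it is
again `c`-torsion-free. -/
theorem IsDualizing.ext_subsingleton {K : Submodule A Q} (hK : IsDualizing K) {M : Type u}
    [AddCommGroup M] [Module A M] (e : M ≃ₗ[A] K) {c : A} (hc : c ∈ nonZeroDivisors A)
    (hcm : c ∈ maximalIdeal A) (i : ℕ) (Y : Type u) [AddCommGroup Y] [Module A Y]
    [Module.Finite A Y] (hY : ∀ y : Y, c • y = 0 → y = 0) :
    Subsingleton (Ext (ModuleCat.of A Y) (ModuleCat.of A M) (i + 1)) := by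
  induction i generalizing Y with
  | zero =>
    obtain ⟨n, f, hf⟩ := Module.Finite.exists_fin' A Y
    have hS := LinearMap.shortExact_shortComplexKer hf
    refine subsingleton_of_forall_eq 0 fun x => ?_
    obtain ⟨x, rfl⟩ := precomp_extClass_surjective_of_projective_X₂ (ModuleCat.of A M) hS 0 x
    obtain ⟨g, rfl⟩ := Ext.addEquiv₀.symm.surjective x
    obtain ⟨ψ, hψ⟩ := hK.exists_extend hc hcm (LinearMap.ker f) (fun x hx => by
      rw [LinearMap.mem_ker, map_smul] at hx
      exact hY _ hx) (e.toLinearMap ∘ₗ g.hom)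
    have : g = f.shortComplexKer.f ≫ ModuleCat.ofHom (e.symm.toLinearMap ∘ₗ ψ) := by
      ext x
      have := LinearMap.congr_fun hψ x
      exact (e.symm_apply_eq.2 this).symm
    rw [this]
    change hS.extClass.comp (Ext.mk₀ (_ ≫ _)) (add_comm 1 0) = 0
    rw [← Ext.mk₀_comp_mk₀, hS.extClass_comp_assoc]
  | succ i ih =>
    obtain ⟨n, f, hf⟩ := Module.Finite.exists_fin' A Y
    have hS := LinearMap.shortExact_shortComplexKer hf
    have := ih (LinearMap.ker f) fun y hy => by
      ext j
      have := congrFun (congrArg Subtype.val hy) j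
      exact (mul_left_mem_nonZeroDivisors_eq_zero_iff hc).1 this
    refine subsingleton_of_forall_eq 0 fun x => ?_
    obtain ⟨x, rfl⟩ := precomp_extClass_surjective_of_projective_X₂ (ModuleCat.of A M) hS (i + 1) x
    rw [Subsingleton.elim x 0, map_zero]

omit [IsNoetherianRing A] [Ring.KrullDimLE 1 A] in
theorem shortExact_residueField :
    (Algebra.linearMap A (ResidueField A)).shortComplexKer.ShortExact :=
  LinearMap.shortExact_shortComplexKer residue_surjective

/-- The residue field is not `c`-torsion-free, but its first syzygy `𝔪` is; one shift explains the
index `i + 2`. -/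
theorem IsDualizing.ext_residueField_subsingleton {K : Submodule A Q} (hK : IsDualizing K)
    {M : Type u} [AddCommGroup M] [Module A M] (e : M ≃ₗ[A] K) {c : A}
    (hc : c ∈ nonZeroDivisors A) (hcm : c ∈ maximalIdeal A) (i : ℕ) :
    Subsingleton (Ext (ModuleCat.of A (ResidueField A)) (ModuleCat.of A M) (i + 2)) := by
  have := hK.ext_subsingleton e hc hcm i (LinearMap.ker (Algebra.linearMap A (ResidueField A)))
    fun y hy => Subtype.ext
      ((mul_left_mem_nonZeroDivisors_eq_zero_iff hc).1 (congrArg Subtype.val hy))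
  refine subsingleton_of_forall_eq 0 fun x => ?_
  obtain ⟨x, rfl⟩ := precomp_extClass_surjective_of_projective_X₂ (ModuleCat.of A M)
    (shortExact_residueField (A := A)) (i + 1) x
  rw [Subsingleton.elim x 0, map_zero]

omit [IsNoetherianRing A] [Ring.KrullDimLE 1 A] in
-- By `0 → 𝔪 → A → k → 0`, `Ext¹(k, K)` is `Hom(𝔪, K)` modulo restrictions from `A`. A homomorphism
-- `φ : 𝔪 → K` is multiplication by `φ(c)/c ∈ K : 𝔪`, and it extends to `A` exactly when this
-- quotient lies in `K`.
theorem length_ext_residueField_one {K : Submodule A Q} {M : Type u} [AddCommGroup M] [Module A M]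
    (e : M ≃ₗ[A] K) {c : A} (hc : c ∈ nonZeroDivisors A) (hcm : c ∈ maximalIdeal A) :
    Module.length A (Ext (ModuleCat.of A (ResidueField A)) (ModuleCat.of A M) 1) =
      relLength K (K / coeSubmodule Q (maximalIdeal A)) := by
  obtain ⟨u, hu⟩ := exists_units_algebraMap (Q := Q) hc
  let r := Algebra.linearMap A (ResidueField A)
  have hr : ∀ x, x ∈ LinearMap.ker r ↔ x ∈ maximalIdeal A := fun x => residue_eq_zero_iff x
  have hS := shortExact_residueField (A := A)
  let g : (K / coeSubmodule Q (maximalIdeal A) : Submodule A Q) →ₗ[A] LinearMap.ker r →ₗ[A] M :=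
    { toFun := fun q => e.symm.toLinearMap ∘ₗ (((LinearMap.mulLeft A (q : Q)) ∘ₗ
          Algebra.linearMap A Q ∘ₗ (LinearMap.ker r).subtype).codRestrict K fun x =>
          Submodule.mem_div_iff_forall_mul_mem.1 q.2 _ ⟨x, (hr x).1 x.2, rfl⟩)
      map_add' := fun p q => by
        ext x
        refine (congrArg e.symm (Subtype.ext ?_)).trans (map_add e.symm _ _)
        exact add_mul _ _ _
      map_smul' := fun a q => by
        ext x
        refine (congrArg e.symm (Subtype.ext ?_)).trans (map_smul e.symm _ _)
        exact smul_mul_assoc _ _ _ }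
  have hg : ∀ q x, (e (g q x) : Q) = q * algebraMap A Q x := fun q x =>
    congrArg Subtype.val (e.apply_symm_apply _)
  let Φ : (K / coeSubmodule Q (maximalIdeal A) : Submodule A Q) →ₗ[A]
      Ext (ModuleCat.of A (ResidueField A)) (ModuleCat.of A M) 1 :=
    hS.extClass.precompOfLinear A (ModuleCat.of A M) (add_comm 1 0) ∘ₗ
      (Ext.linearEquiv₀ (R := A)).symm.toLinearMap ∘ₗ
      (ModuleCat.homLinearEquiv (S := A)).symm.toLinearMap ∘ₗ g
  have hΦ : ∀ q, Φ q = hS.extClass.comp (Ext.mk₀ (ModuleCat.ofHom (g q))) (add_comm 1 0) :=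
    fun q => rfl
  have hsurj : Function.Surjective Φ := by
    intro x
    obtain ⟨x, rfl⟩ := precomp_extClass_surjective_of_projective_X₂ (ModuleCat.of A M) hS 0 x
    obtain ⟨φ, rfl⟩ := Ext.addEquiv₀.symm.surjective x
    let c' : LinearMap.ker r := ⟨c, (hr c).2 hcm⟩
    let q : Q := ((u⁻¹ : Qˣ) : Q) * e (φ.hom c')
    have hq : ∀ x : LinearMap.ker r, q * algebraMap A Q x = e (φ.hom x) := by
      intro x
      have h1 : (x : A) • c' = c • x := Subtype.ext (mul_comm (x : A) c)
      have h2 : (x : A) • (e (φ.hom c') : Q) = c • (e (φ.hom x) : Q) := by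
        have := congrArg (fun y => (e (φ.hom y) : Q)) h1
        simpa using this
      rw [Algebra.smul_def, Algebra.smul_def, ← hu] at h2
      calc q * algebraMap A Q x = ((u⁻¹ : Qˣ) : Q) * (algebraMap A Q x * e (φ.hom c')) := by
            simp only [q]; ring
        _ = _ := by rw [h2, Units.inv_mul_cancel_left]
    have hqm : q ∈ K / coeSubmodule Q (maximalIdeal A) := by
      rw [Submodule.mem_div_iff_forall_mul_mem]
      rintro _ ⟨x, hx, rfl⟩
      have := hq ⟨x, (hr x).2 hx⟩
      exact this ▸ (e _).2
    refine ⟨⟨q, hqm⟩, ?_⟩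
    rw [hΦ]
    have : ModuleCat.ofHom (g ⟨q, hqm⟩) = φ := by
      ext x
      refine e.injective (Subtype.ext ?_)
      exact (hg _ x).trans (hq x)
    rw [this]
    rfl
  have hker : LinearMap.ker Φ = K.submoduleOf _ := by
    ext q
    rw [LinearMap.mem_ker, hΦ]
    constructor
    · intro h
      obtain ⟨y, hy⟩ := Ext.contravariant_sequence_exact₁ hS (ModuleCat.of A M) _ _ h
      obtain ⟨ψ, rfl⟩ := Ext.addEquiv₀.symm.surjective y
      change (Ext.mk₀ _).comp (Ext.mk₀ ψ) _ = _ at hy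
      rw [Ext.mk₀_comp_mk₀] at hy
      have hy := Ext.addEquiv₀.symm.injective hy
      have hmem : (q : Q) = e (ψ.hom (1 : A)) := by
        let c' : LinearMap.ker r := ⟨c, (hr c).2 hcm⟩
        have h1 : (e (g q c') : Q) = e (ψ.hom c) := by
          have := congrArg (fun f => (e (f.hom c') : Q)) hy
          exact this.symm
        have h2 : ψ.hom c = c • ψ.hom (1 : A) := by
          rw [← map_smul, smul_eq_mul, mul_one]
        rw [hg, h2, map_smul] at h1
        change q * algebraMap A Q c = c • (e (ψ.hom (1 : A)) : Q) at h1
        rw [Algebra.smul_def, ← hu, mul_comm] at h1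
        exact u.mul_right_inj.1 h1
      change (q : Q) ∈ K
      exact hmem ▸ (e _).2
    · intro h
      have h : (q : Q) ∈ K := h
      let ψ : A →ₗ[A] M := LinearMap.toSpanSingleton A M (e.symm ⟨q, h⟩)
      have : ModuleCat.ofHom (g q) = r.shortComplexKer.f ≫ ModuleCat.ofHom ψ := by
        ext x
        refine e.injective (Subtype.ext ?_)
        refine (hg _ x).trans ?_
        change _ = (e ((x : A) • e.symm ⟨q, h⟩) : Q)
        rw [map_smul, e.apply_symm_apply]
        change _ = (x : A) • (q : Q)
        rw [Algebra.smul_def, mul_comm]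
      rw [this, ← Ext.mk₀_comp_mk₀, hS.extClass_comp_assoc]
  rw [relLength, ← (LinearMap.quotKerEquivOfSurjective Φ hsurj).length_eq, hker]

/-- In dimension one, the canonical modules are the dualizing fractional ideals. -/
theorem isCanonicalModule_iff_isDualizing (hdim : ringKrullDim A = 1) {K : Submodule A Q}
    (hu : ∃ u : Qˣ, (u : Q) ∈ K) {M : Type u} [AddCommGroup M] [Module A M] (e : M ≃ₗ[A] K)
    (hA : ∃ c ∈ maximalIdeal A, c ∈ nonZeroDivisors A) :
    IsCanonicalModule A M ↔ IsDualizing K := by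
  obtain ⟨c, hcm, hc⟩ := hA
  constructor
  · rintro ⟨hfin, h⟩
    have := Module.Finite.equiv e
    refine ⟨Module.Finite.iff_fg.1 this, hu, ?_⟩
    rw [← length_ext_residueField_one e hc hcm]
    exact (h 1).1 (by rw [hdim]; rfl)
  · intro hK
    have := Module.Finite.iff_fg.2 hK.fg
    refine ⟨Module.Finite.equiv e.symm, fun i => ⟨fun h => ?_, fun h => ?_⟩⟩
    · have : i = 1 := by
        rw [hdim] at h
        exact_mod_cast h
      subst this
      rw [length_ext_residueField_one e hc hcm, hK.relLength_socle]
    · have : i ≠ 1 := by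
        rintro rfl
        exact h (by rw [hdim]; rfl)
      rw [Module.length_eq_zero_iff]
      match i, this with
      | 0, _ =>
        -- `Hom(k, M) = 0`: `c` kills `k` but acts injectively on `K ⊆ Q`.
        refine (Ext.addEquiv₀.trans ModuleCat.homAddEquiv).toEquiv.subsingleton_congr.2 ?_
        refine subsingleton_of_forall_eq 0 fun f => ?_
        ext x
        obtain ⟨u, hu⟩ := exists_units_algebraMap (Q := Q) hc
        have h1 : c • x = 0 := by
          rw [Algebra.smul_def]
          have : algebraMap A (ResidueField A) c = 0 := (residue_eq_zero_iff c).2 hcm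
          rw [this, zero_mul]
        have h2 : c • (e (f x) : Q) = 0 := by
          have := congrArg (fun y => (e (f y) : Q)) h1
          simpa using this
        rw [Algebra.smul_def, ← hu, Units.mul_right_eq_zero] at h2
        exact e.injective (by rw [LinearMap.zero_apply, map_zero]; exact Subtype.ext h2)
      | i + 2, _ => exact hK.ext_residueField_subsingleton e hc hcm i

end Ext

/-! ### Sally modules: generation in degree one. -/

section Sally

open IsLocalRing Submodule

variable {A : Type u} [CommRing A]

instance ReesRing.instIsScalarTower (Q : Ideal A) : IsScalarTower A (ReesRing Q) A[X] :=
  inferInstanceAs (IsScalarTower A ↥(reesAlgebra Q) A[X])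

theorem mem_sallyNumerator {Q J : Ideal A} {h : Q ≤ J} {f : A[X]} :
    f ∈ sallyNumerator Q J h ↔ ∀ i, f.coeff i ∈ J ^ (i + 1) := Iff.rfl

theorem mem_sallyDenominator {Q J : Ideal A} {f : A[X]} :
    f ∈ sallyDenominator Q J ↔ ∀ i, f.coeff i ∈ J * Q ^ i := Iff.rfl

theorem monomial_mem_sallyNumerator {Q J : Ideal A} {h : Q ≤ J} {i : ℕ} {y : A}
    (hy : y ∈ J ^ (i + 1)) : monomial i y ∈ sallyNumerator Q J h := by
  intro j
  rw [coeff_monomial]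
  split_ifs with hij
  · exact hij ▸ hy
  · exact zero_mem _

theorem monomial_mem_sallyDenominator {Q J : Ideal A} {i : ℕ} {y : A}
    (hy : y ∈ J * Q ^ i) : monomial i y ∈ sallyDenominator Q J := by
  intro j
  rw [coeff_monomial]
  split_ifs with hij
  · exact hij ▸ hy
  · exact zero_mem _

theorem pow_eq_of_pow_three_eq {Q J : Ideal A} (h3 : J ^ 3 = Q * J ^ 2) (i : ℕ) :
    J ^ (i + 2) = Q ^ i * J ^ 2 := by
  induction i with
  | zero => simp
  | succ i ih =>
    rw [pow_succ Q, mul_assoc, ← h3, pow_succ J 2, ← mul_assoc, ← ih, ← pow_succ]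

/-- The component of degree `2` of a Sally module generated in degree one. -/
theorem pow_three_eq_of_sallyGeneratedInDegreeOne {Q J : Ideal A} (h : Q ≤ J)
    (hgen : SallyGeneratedInDegreeOne Q J h) : J ^ 3 = Q * J ^ 2 := by
  refine le_antisymm ?_ (by rw [pow_succ' J 2]; exact Ideal.mul_mono_left h)
  -- A Rees submodule containing the denominator and all homogeneous elements of degree one, hence
  -- everything; the degree-two component then gives `J³ ⊆ QJ²`.
  let N : Submodule (ReesRing Q) (sallyNumerator Q J h) :=
    { carrier := {f | (f : A[X]).coeff 2 ∈ (Q * J ^ 2 : Ideal A)}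
      zero_mem' := (Q * J ^ 2 : Ideal A).zero_mem
      add_mem' := fun {f g} hf hg => by
        change ((f : A[X]) + g).coeff 2 ∈ (Q * J ^ 2 : Ideal A)
        rw [coeff_add]
        exact add_mem hf hg
      smul_mem' := fun c f hf => by
        change (c.1 * (f : A[X])).coeff 2 ∈ (Q * J ^ 2 : Ideal A)
        have hf0 := mem_sallyNumerator.1 f.2 0
        have hf1 := mem_sallyNumerator.1 f.2 1
        have hc1 := c.2 1
        have hc2 := c.2 2
        rw [coeff_mul]
        refine Ideal.sum_mem _ fun x hx => ?_
        obtain ⟨i, j⟩ := x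
        have hij : i + j = 2 := Finset.HasAntidiagonal.mem_antidiagonal.mp hx
        have : i = 0 ∧ j = 2 ∨ i = 1 ∧ j = 1 ∨ i = 2 ∧ j = 0 := by omega
        rcases this with ⟨rfl, rfl⟩ | ⟨rfl, rfl⟩ | ⟨rfl, rfl⟩
        · exact Ideal.mul_mem_left _ _ hf
        · rw [pow_one] at hc1
          exact Ideal.mul_mem_mul hc1 hf1
        · have := Ideal.mul_mem_mul hc2 hf0
          refine (?_ : Q ^ 2 * J ^ (0 + 1) ≤ Q * J ^ 2) this
          rw [pow_two, pow_two, mul_assoc]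
          exact Ideal.mul_mono le_rfl (Ideal.mul_mono h (by simp)) }
  have hN : (sallyDenominator Q J).submoduleOf (sallyNumerator Q J h) ≤ N := by
    intro f hf
    have := mem_sallyDenominator.1 hf 2
    refine (?_ : J * Q ^ 2 ≤ Q * J ^ 2) this
    rw [pow_two, pow_two, mul_left_comm]
    exact Ideal.mul_mono le_rfl (Ideal.mul_mono le_rfl h)
  have htop : N.map (mkQ ((sallyDenominator Q J).submoduleOf (sallyNumerator Q J h))) = ⊤ := by
    rw [eq_top_iff, ← hgen, span_le]
    rintro _ ⟨f, hf, rfl⟩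
    refine mem_map_of_mem ?_
    change (f : A[X]).coeff 2 ∈ (Q * J ^ 2 : Ideal A)
    rw [hf 2 (by norm_num)]
    exact zero_mem _
  intro y hy
  have hmem : Submodule.Quotient.mk ⟨monomial 2 y, monomial_mem_sallyNumerator hy⟩ ∈
    N.map (mkQ ((sallyDenominator Q J).submoduleOf (sallyNumerator Q J h))) := htop ▸ mem_top
  have : (⟨monomial 2 y, monomial_mem_sallyNumerator hy⟩ : sallyNumerator Q J h) ∈ N := by
    have := comap_map_mkQ ((sallyDenominator Q J).submoduleOf (sallyNumerator Q J h)) N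
    rw [sup_eq_right.2 hN] at this
    rw [← this]
    exact hmem
  have : (monomial 2 y).coeff 2 ∈ Q * J ^ 2 := this
  rwa [coeff_monomial_same] at this

/-- Since `J^(i+2) = a^i J²`, a monomial of degree `i + 1` is `(at)^i` times one of degree one. In
degree zero the quotient vanishes. -/
theorem sallyGeneratedInDegreeOne_of_pow_three_eq {a : A} {J : Ideal A} (h : Ideal.span {a} ≤ J)
    (h3 : J ^ 3 = Ideal.span {a} * J ^ 2) :
    SallyGeneratedInDegreeOne (Ideal.span {a}) J h := by
  rw [SallyGeneratedInDegreeOne, eq_top_iff]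
  rintro s -
  obtain ⟨⟨f, hf⟩, rfl⟩ := Submodule.Quotient.mk_surjective _ s
  have key : ∀ i, (⟨monomial i (f.coeff i), monomial_mem_sallyNumerator (hf i)⟩ :
      sallyNumerator (Ideal.span {a}) J h) ∈
      (span (ReesRing (Ideal.span {a})) (sallyComponent (Ideal.span {a}) J h 1)).comap
        (mkQ _) := by
    intro i
    match i with
    | 0 =>
      rw [mem_comap, mkQ_apply, (Submodule.Quotient.mk_eq_zero _).2]
      · exact zero_mem _
      · refine monomial_mem_sallyDenominator ?_
        simpa using hf 0
    | i + 1 =>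
      have h1 := hf (i + 1)
      have h2 : f.coeff (i + 1) ∈ Ideal.span {a} ^ i * J ^ 2 := pow_eq_of_pow_three_eq h3 i ▸ h1
      rw [Ideal.span_singleton_pow, Ideal.mem_span_singleton_mul] at h2
      obtain ⟨y, hy, hy'⟩ := h2
      let c : ReesRing (Ideal.span {a}) := ⟨monomial i (a ^ i),
        reesAlgebra.monomial_mem.2 (Ideal.pow_mem_pow (Ideal.mem_span_singleton_self a) i)⟩
      have h3 : (⟨monomial (i + 1) (f.coeff (i + 1)), monomial_mem_sallyNumerator (hf (i + 1))⟩ :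
          sallyNumerator (Ideal.span {a}) J h) =
          c • ⟨monomial 1 y, monomial_mem_sallyNumerator hy⟩ := by
        refine Subtype.ext ?_
        change _ = monomial i (a ^ i) * monomial 1 y
        rw [monomial_mul_monomial, hy']
      rw [h3]
      refine smul_mem _ _ (subset_span ⟨_, fun j hj => ?_, rfl⟩)
      exact coeff_monomial_of_ne _ hj
  have hsum : (⟨f, hf⟩ : sallyNumerator (Ideal.span {a}) J h) =
      ∑ i ∈ f.support, ⟨monomial i (f.coeff i), monomial_mem_sallyNumerator (hf i)⟩ := by
    refine Subtype.ext ?_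
    rw [AddSubmonoidClass.coe_finsetSum]
    exact f.as_sum_support
  have := sum_mem (fun i (_ : i ∈ f.support) => key i)
  rw [← hsum] at this
  exact this

/-! ### Rank of the Sally module of a principal reduction. -/

section Rank

variable {a : A}

theorem Polynomial.coeff_aeval_C_mul_X (f : A[X]) (i : ℕ) :
    (aeval (C a * X) f).coeff i = a ^ i * f.coeff i := by
  have : aeval (C a * X) f = f.comp (C a * X) := rfl
  rw [this, comp_C_mul_X_coeff, mul_comm]

/-- The Rees algebra of a principal ideal generated by a nonzerodivisor is a polynomial ring. -/
noncomputable def ReesRing.equivPolynomial (ha : a ∈ nonZeroDivisors A) :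
    A[X] ≃ₐ[A] ReesRing (Ideal.span {a}) :=
  AlgEquiv.ofBijective
    ((aeval (C a * X) : A[X] →ₐ[A] A[X]).codRestrict (reesAlgebra (Ideal.span {a})) (by
      intro f i
      rw [coeff_aeval_C_mul_X, Ideal.span_singleton_pow]
      exact Ideal.mul_mem_right _ _ (Ideal.mem_span_singleton_self _)) :
      A[X] →ₐ[A] (reesAlgebra (Ideal.span {a}))) (by
    constructor
    · intro f g h
      have h : (aeval (C a * X) f : A[X]) = aeval (C a * X) g := congrArg Subtype.val h
      ext i
      have := congrArg (fun p => p.coeff i) h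
      simp only [coeff_aeval_C_mul_X] at this
      exact (mul_cancel_left_mem_nonZeroDivisors (pow_mem ha i)).1 this
    · rintro ⟨g, hg⟩
      have h1 : ∀ i, ∃ r, a ^ i * r = g.coeff i := fun i => by
        have := hg i
        rw [Ideal.span_singleton_pow, Ideal.mem_span_singleton'] at this
        obtain ⟨r, hr⟩ := this
        exact ⟨r, by rw [mul_comm, hr]⟩
      choose r hr using h1
      refine ⟨∑ i ∈ g.support, monomial i (r i), Subtype.ext ?_⟩
      change aeval (C a * X) (∑ i ∈ g.support, monomial i (r i)) = g
      ext j
      rw [coeff_aeval_C_mul_X, finsetSum_coeff]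
      simp only [coeff_monomial, Finset.sum_ite_eq', mem_support_iff]
      split_ifs with h
      · exact hr j
      · rw [mul_zero, notMem_support_iff.1 h])

theorem ReesRing.equivPolynomial_monomial (ha : a ∈ nonZeroDivisors A) (i : ℕ) :
    (ReesRing.equivPolynomial ha (monomial i 1)).1 = monomial i (a ^ i) := by
  change aeval (C a * X) (monomial i (1 : A)) = _
  ext j
  rw [coeff_aeval_C_mul_X, coeff_monomial, coeff_monomial]
  split_ifs with h
  · rw [h, mul_one]
  · rw [mul_zero]

/-- The Rees algebra of a principal regular ideal is free, with basis the powers of `at`. -/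
noncomputable def ReesRing.basis (ha : a ∈ nonZeroDivisors A) :
    Module.Basis ℕ A (ReesRing (Ideal.span {a})) :=
  (basisMonomials A).map (ReesRing.equivPolynomial ha).toLinearEquiv

theorem ReesRing.basis_apply (ha : a ∈ nonZeroDivisors A) (i : ℕ) :
    (ReesRing.basis ha i).1 = monomial i (a ^ i) := by
  rw [ReesRing.basis, Module.Basis.map_apply, coe_basisMonomials]
  exact ReesRing.equivPolynomial_monomial ha i

theorem ReesRing.isPrime_map (ha : a ∈ nonZeroDivisors A) (P : Ideal A) [P.IsPrime] :
    (P.map (algebraMap A (ReesRing (Ideal.span {a})))).IsPrime := by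
  have : P.map (algebraMap A (ReesRing (Ideal.span {a}))) =
      (P.map (C : A →+* A[X])).map ((ReesRing.equivPolynomial ha).toRingEquiv : A[X] →+* _) := by
    rw [Ideal.map_map]
    congr 1
    ext r
    exact ((ReesRing.equivPolynomial ha).commutes r).symm
  rw [this]
  exact Ideal.map_isPrime_of_equiv (ReesRing.equivPolynomial ha).toRingEquiv

variable {J : Ideal A} (h : Ideal.span {a} ≤ J)

/-- The inclusion of `J ^ 2 / Q J` in the Sally module as the component of degree one. -/
noncomputable def sallyDegreeOne (Q J : Ideal A) (h : Q ≤ J) :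
    (↥(J ^ 2) ⧸ (Q * J).submoduleOf (J ^ 2)) →ₗ[A] SallyModule Q J h :=
  ((Q * J).submoduleOf (J ^ 2)).liftQ
    ((((sallyDenominator Q J).submoduleOf (sallyNumerator Q J h)).mkQ.restrictScalars A) ∘ₗ
      { toFun := fun y => ⟨monomial 1 (y : A), monomial_mem_sallyNumerator y.2⟩
        map_add' := fun x y => Subtype.ext (map_add (monomial 1) (x : A) y)
        map_smul' := fun r y => Subtype.ext (map_smul (monomial 1) r (y : A)) }) (by
    intro y hy
    refine (Submodule.Quotient.mk_eq_zero _).2 (monomial_mem_sallyDenominator ?_)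
    rw [pow_one, mul_comm]
    exact hy)

theorem sallyDegreeOne_mk (Q J : Ideal A) (h : Q ≤ J) (y : ↥(J ^ 2)) :
    sallyDegreeOne Q J h (Submodule.Quotient.mk y) =
      Submodule.Quotient.mk ⟨monomial 1 (y : A), monomial_mem_sallyNumerator y.2⟩ := rfl

open TensorProduct in
/-- The Sally module of a principal reduction with `J ^ 3 = Q J ^ 2` is extended from
`J ^ 2 / Q J`. -/
noncomputable def sallyModuleEquiv (ha : a ∈ nonZeroDivisors A)
    (h3 : J ^ 3 = Ideal.span {a} * J ^ 2) :
    ReesRing (Ideal.span {a}) ⊗[A] (↥(J ^ 2) ⧸ (Ideal.span {a} * J).submoduleOf (J ^ 2))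
      ≃ₗ[ReesRing (Ideal.span {a})] SallyModule (Ideal.span {a}) J h :=
  LinearEquiv.ofBijective (LinearMap.liftBaseChange _ (sallyDegreeOne (Ideal.span {a}) J h)) (by
    constructor
    · rw [injective_iff_map_eq_zero]
      intro x hx
      obtain ⟨m, rfl⟩ :=
        (TensorProduct.equivFinsuppOfBasisLeft (ReesRing.basis ha)).symm.surjective x
      have hy : ∀ i, ∃ y : ↥(J ^ 2), Submodule.Quotient.mk y = m i := fun i =>
        Submodule.Quotient.mk_surjective _ (m i)
      choose y hy using hy
      have e : (LinearMap.liftBaseChange _ (sallyDegreeOne (Ideal.span {a}) J h))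
          ((TensorProduct.equivFinsuppOfBasisLeft (ReesRing.basis ha)).symm m) =
          Submodule.Quotient.mk (∑ i ∈ m.support,
            (ReesRing.basis ha i) •
              ⟨monomial 1 (y i : A), monomial_mem_sallyNumerator (y i).2⟩) := by
        rw [TensorProduct.equivFinsuppOfBasisLeft_symm_apply, Finsupp.sum, map_sum]
        rw [← Submodule.mkQ_apply, map_sum]
        refine Finset.sum_congr rfl fun i _ => ?_
        rw [LinearMap.liftBaseChange_tmul, ← hy, sallyDegreeOne_mk]
        rfl
      rw [e, Submodule.Quotient.mk_eq_zero] at hx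
      have hm : m = 0 := by
        ext i
        by_cases hi : i ∈ m.support
        · have h1 := mem_sallyDenominator.1 hx (i + 1)
          have h2 : (((∑ i ∈ m.support, (ReesRing.basis ha i) •
              ⟨monomial 1 (y i : A), monomial_mem_sallyNumerator (y i).2⟩ :
              sallyNumerator (Ideal.span {a}) J h)) : A[X]).coeff (i + 1) = a ^ i * y i := by
            rw [AddSubmonoidClass.coe_finsetSum, finsetSum_coeff, Finset.sum_eq_single i]
            · change ((ReesRing.basis ha i).1 * monomial 1 (y i : A)).coeff (i + 1) = _
              rw [ReesRing.basis_apply, monomial_mul_monomial, coeff_monomial_same]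
            · intro j _ hj
              change ((ReesRing.basis ha j).1 * monomial 1 (y j : A)).coeff (i + 1) = _
              rw [ReesRing.basis_apply, monomial_mul_monomial, coeff_monomial_of_ne]
              omega
            · intro h
              exact absurd hi h
          change (((∑ i ∈ m.support, (ReesRing.basis ha i) •
              ⟨monomial 1 (y i : A), monomial_mem_sallyNumerator (y i).2⟩ :
              sallyNumerator (Ideal.span {a}) J h)) : A[X]).coeff (i + 1) ∈ _ at h1
          rw [h2, Ideal.span_singleton_pow, mul_comm J, Ideal.mem_span_singleton_mul] at h1
          obtain ⟨z, hz, hz'⟩ := h1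
          rw [pow_succ, mul_assoc] at hz'
          have hz' := (mul_cancel_left_mem_nonZeroDivisors (pow_mem ha i)).1 hz'
          rw [← hy, Finsupp.zero_apply, Submodule.Quotient.mk_eq_zero]
          change (y i : A) ∈ Ideal.span {a} * J
          rw [← hz']
          exact Ideal.mul_mem_mul (Ideal.mem_span_singleton_self a) hz
        · exact Finsupp.notMem_support_iff.1 hi
      rw [hm, map_zero]
    · rw [← LinearMap.range_eq_top, eq_top_iff, ← sallyGeneratedInDegreeOne_of_pow_three_eq h h3,
        span_le]
      rintro _ ⟨f, hf, rfl⟩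
      refine ⟨1 ⊗ₜ Submodule.Quotient.mk ⟨(f : A[X]).coeff 1, f.2 1⟩, ?_⟩
      rw [LinearMap.liftBaseChange_tmul, one_smul, sallyDegreeOne_mk]
      congr 1
      refine Subtype.ext (Polynomial.ext fun i => ?_)
      change (monomial 1 ((f : A[X]).coeff 1)).coeff i = _
      rw [coeff_monomial]
      split_ifs with h
      · rw [h]
      · exact (hf i (Ne.symm h)).symm)

open TensorProduct in
-- The Sally module is `J²/aJ` extended to the Rees algebra. The localization at `𝔪T` is flat and
-- local over `A`, and `𝔪` generates its maximal ideal, so base change preserves length.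
theorem sallyHasRank_iff [IsLocalRing A] (ha : a ∈ nonZeroDivisors A)
    (h3 : J ^ 3 = Ideal.span {a} * J ^ 2) (n : ℕ) :
    SallyHasRank (Ideal.span {a}) J h n ↔ relLength (Ideal.span {a} * J) (J ^ 2) = n := by
  have hp := ReesRing.isPrime_map ha (maximalIdeal A)
  set T := ReesRing (Ideal.span {a}) with hT
  set p : Ideal T := (maximalIdeal A).map (algebraMap A T) with hpdef
  have key : Module.length (Localization.AtPrime p)
      (LocalizedModule p.primeCompl (SallyModule (Ideal.span {a}) J h)) =
      relLength (Ideal.span {a} * J) (J ^ 2) := by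
    have : Module.Free A T := Module.Free.of_basis (ReesRing.basis ha)
    have : Module.Flat A (Localization.AtPrime p) := Module.Flat.trans A T _
    have hmap : (maximalIdeal A).map (algebraMap A (Localization.AtPrime p)) =
        maximalIdeal (Localization.AtPrime p) := by
      rw [IsScalarTower.algebraMap_eq A T (Localization.AtPrime p), ← Ideal.map_map,
        Localization.AtPrime.map_eq_maximalIdeal]
    have : IsLocalHom (algebraMap A (Localization.AtPrime p)) :=
      ((IsLocalRing.local_hom_TFAE (algebraMap A (Localization.AtPrime p))).out 0 2).2 hmap.le
    have e := (LocalizedModule.equivTensorProduct p.primeCompl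
      (SallyModule (Ideal.span {a}) J h)).trans
      ((TensorProduct.AlgebraTensorModule.congr (LinearEquiv.refl (Localization.AtPrime p) _)
        (sallyModuleEquiv h ha h3).symm).trans
      (TensorProduct.AlgebraTensorModule.cancelBaseChange A T (Localization.AtPrime p)
        (Localization.AtPrime p) (↥(J ^ 2) ⧸ (Ideal.span {a} * J).submoduleOf (J ^ 2))))
    rw [e.length_eq, IsLocalRing.length_baseChange, hmap]
    have : IsSimpleModule (Localization.AtPrime p)
        (Localization.AtPrime p ⧸ maximalIdeal (Localization.AtPrime p)) :=
      isSimpleModule_iff_isCoatom.2 (maximalIdeal.isMaximal _).out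
    rw [Module.length_eq_one (Localization.AtPrime p)
      (Localization.AtPrime p ⧸ maximalIdeal (Localization.AtPrime p)), mul_one]
    rfl
  constructor
  · rintro ⟨_, h⟩
    rw [← h, ← key]
  · intro h
    exact ⟨hp, by rw [← h, ← key]⟩

end Rank

end Sally

/-! ### One-dimensional Cohen–Macaulay local rings. -/

section CohenMacaulay

open IsLocalRing

variable {A : Type u} [CommRing A] [IsLocalRing A]

theorem IsCohenMacaulayLocal.exists_mem_nonZeroDivisors (hA : IsCohenMacaulayLocal A)
    (hdim : ringKrullDim A = 1) : ∃ c ∈ maximalIdeal A, c ∈ nonZeroDivisors A := by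
  obtain ⟨-, rs, hm, hreg, hlen⟩ := hA
  rw [hdim] at hlen
  have hlen : rs.length = 1 := by exact_mod_cast hlen
  obtain ⟨c, rfl⟩ := List.length_eq_one_iff.1 hlen
  refine ⟨c, hm c (List.mem_singleton_self c), ?_⟩
  have := ((RingTheory.Sequence.isRegular_cons_iff A c []).1 hreg).1
  refine mem_nonZeroDivisors_iff_right.2 fun x hx => ?_
  exact this (show c * x = c * 0 by rw [mul_zero, mul_comm, hx])

theorem isCohenMacaulayLocal_of_mem_nonZeroDivisors [IsNoetherianRing A]
    (hdim : ringKrullDim A = 1) {c : A} (hcm : c ∈ maximalIdeal A) (hc : c ∈ nonZeroDivisors A) :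
    IsCohenMacaulayLocal A := by
  refine ⟨inferInstance, [c], by simpa using hcm, ?_, by rw [hdim]; rfl⟩
  rw [IsLocalRing.isRegular_iff_isWeaklyRegular_of_subset_maximalIdeal (by simpa using hcm),
    RingTheory.Sequence.isWeaklyRegular_singleton_iff]
  exact fun x y h => (mul_cancel_left_mem_nonZeroDivisors hc).1 h

omit [IsLocalRing A] in
theorem krullDimLE_one_of_ringKrullDim_eq (hdim : ringKrullDim A = 1) : Ring.KrullDimLE 1 A :=
  Ring.krullDimLE_iff.2 hdim.le

end CohenMacaulay

/-! ### The Goto property through fractional ideals. -/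

section Goto

open IsLocalization IsLocalRing Submodule

variable {A : Type u} [CommRing A]

omit [CommRing A] in
theorem range_fin_one (a : Fin 1 → A) : Set.range a = {a 0} := by
  ext x
  constructor
  · rintro ⟨i, rfl⟩
    exact congrArg a (Subsingleton.elim i 0)
  · rintro rfl
    exact ⟨0, rfl⟩

theorem coeSubmodule_pow {Q : Type*} [CommRing Q] [Algebra A Q] (I : Ideal A) (n : ℕ) :
    coeSubmodule Q (I ^ n) = coeSubmodule Q I ^ n := by
  induction n with
  | zero => simp [coeSubmodule_top]
  | succ n ih => rw [pow_succ, pow_succ, coeSubmodule_mul, ih]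

variable {Q : Type*} [CommRing Q] [Algebra A Q] [IsFractionRing A Q]

theorem relLength_coeSubmodule (I J : Ideal A) :
    relLength (coeSubmodule Q I) (coeSubmodule Q J) = relLength I J :=
  relLength_map (Algebra.linearMap A Q) (IsFractionRing.injective A Q) I J

/-- Scaling translates the reduction condition `I ^ 3 = a I ^ 2`. -/
theorem pow_three_eq_iff_of_coeSubmodule_eq {I : Ideal A} {d : A} {u : Qˣ}
    (hu : (u : Q) = algebraMap A Q d) {K : Submodule A Q}
    (hK : coeSubmodule Q I = span A {(u : Q)} * K) :
    I ^ 3 = Ideal.span {d} * I ^ 2 ↔ K ^ 3 = K ^ 2 := by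
  rw [← (coeSubmodule_injective Q (M := nonZeroDivisors A) le_rfl).eq_iff, coeSubmodule_mul,
    coeSubmodule_pow, coeSubmodule_pow, coeSubmodule_span_singleton, ← hu, hK]
  have h1 : (span A {(u : Q)} * K) ^ 3 = span A {(u : Q)} ^ 3 * K ^ 3 := by ring
  have h2 : span A {(u : Q)} * (span A {(u : Q)} * K) ^ 2 = span A {(u : Q)} ^ 3 * K ^ 2 := by ring
  rw [h1, h2, span_pow, Set.singleton_pow, ← Units.val_pow_eq_pow_val]
  constructor
  · intro h
    rw [← span_inv_mul_cancel (u ^ 3) (K ^ 3), h, span_inv_mul_cancel]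
  · intro h
    rw [h]

theorem relLength_eq_of_coeSubmodule_eq {I : Ideal A} {d : A} {u : Qˣ}
    (hu : (u : Q) = algebraMap A Q d) {K : Submodule A Q}
    (hK : coeSubmodule Q I = span A {(u : Q)} * K) :
    relLength (Ideal.span {d} * I) (I ^ 2) = relLength K (K ^ 2) := by
  rw [← relLength_coeSubmodule (Q := Q), coeSubmodule_mul, coeSubmodule_pow,
    coeSubmodule_span_singleton, ← hu, hK]
  have : (span A {(u : Q)} * K) ^ 2 = span A {(u : Q)} * (span A {(u : Q)} * K ^ 2) := by ring
  rw [this, relLength_span_unit_mul, relLength_span_unit_mul]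

variable [IsLocalRing A]

theorem isDualizing_of_isCanonicalIdeal [IsNoetherianRing A] [Ring.KrullDimLE 1 A]
    (hdim : ringKrullDim A = 1) (hA : ∃ c ∈ maximalIdeal A, c ∈ nonZeroDivisors A) {I : Ideal A}
    (hI : ∃ d ∈ I, d ∈ nonZeroDivisors A) :
    IsCanonicalModule A I ↔ IsDualizing (coeSubmodule Q I) := by
  obtain ⟨d, hdI, hd⟩ := hI
  obtain ⟨u, hu⟩ := exists_units_algebraMap (Q := Q) hd
  exact isCanonicalModule_iff_isDualizing hdim ⟨u, (mem_coeSubmodule Q I).2 ⟨d, hdI, hu.symm⟩⟩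
    (Submodule.equivMapOfInjective _ (IsFractionRing.injective A Q) I) hA

omit [IsLocalRing A] in
theorem mem_nonZeroDivisors_of_mem_span {c d : A} (hc : c ∈ nonZeroDivisors A)
    (h : c ∈ Ideal.span {d}) : d ∈ nonZeroDivisors A := by
  obtain ⟨r, rfl⟩ := Ideal.mem_span_singleton'.1 h
  exact (mul_mem_nonZeroDivisors.1 hc).2

theorem mem_nonZeroDivisors_of_isSystemOfParameters
    (hA : ∃ c ∈ maximalIdeal A, c ∈ nonZeroDivisors A) {d : A}
    (h : (Ideal.span {d}).radical = maximalIdeal A) : d ∈ nonZeroDivisors A := by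
  obtain ⟨c, hcm, hc⟩ := hA
  rw [← h] at hcm
  obtain ⟨k, hk⟩ := hcm
  exact mem_nonZeroDivisors_of_mem_span (pow_mem hc k) hk

/-- A canonical ideal with a parameter `d`, rescaled by `d`. -/
theorem IsCanonicalIdeal.exists_isDualizing [IsNoetherianRing A] [Ring.KrullDimLE 1 A]
    (hdim : ringKrullDim A = 1) (hA : ∃ c ∈ maximalIdeal A, c ∈ nonZeroDivisors A) {I : Ideal A}
    (hI : IsCanonicalIdeal I) {d : A} (hdI : d ∈ I) (hd : d ∈ nonZeroDivisors A) :
    ∃ (u : Qˣ) (K : Submodule A Q), (u : Q) = algebraMap A Q d ∧ IsDualizing K ∧ 1 ≤ K ∧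
      coeSubmodule Q I = span A {(u : Q)} * K := by
  obtain ⟨u, hu⟩ := exists_units_algebraMap (Q := Q) hd
  have hD := (isDualizing_of_isCanonicalIdeal (Q := Q) hdim hA ⟨d, hdI, hd⟩).1 hI.2
  refine ⟨u, span A {((u⁻¹ : Qˣ) : Q)} * coeSubmodule Q I, hu, hD.span_unit_mul u⁻¹, ?_,
    (span_unit_mul_cancel u _).symm⟩
  rw [← span_unit_mul_le_iff, mul_one, span_singleton_le_iff_mem]
  exact ⟨d, hdI, hu.symm⟩

/-- The Goto property of a one-dimensional ring in terms of dualizing fractional ideals. -/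
theorem isGoto_iff_exists_isDualizing (hCM : IsCohenMacaulayLocal A) (hdim : ringKrullDim A = 1)
    (n : ℕ) :
    IsGoto n A ↔ ∃ K : Submodule A Q, IsDualizing K ∧ 1 ≤ K ∧ K ^ 3 = K ^ 2 ∧
      relLength K (K ^ 2) = n := by
  have := hCM.1
  have := krullDimLE_one_of_ringKrullDim_eq hdim
  have hA := hCM.exists_mem_nonZeroDivisors hdim
  -- The Sally module depends on a proof of `P ≤ J`, so replacing `I ⊔ (a)` by `I` is done by
  -- substitution for all ideals at once.
  have aux : ∀ (P J P' J' : Ideal A) (h : P ≤ J) (h' : P' ≤ J'), P = P' → J = J' →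
      ((SallyHasRank P J h n ∧ SallyGeneratedInDegreeOne P J h) ↔
        (SallyHasRank P' J' h' n ∧ SallyGeneratedInDegreeOne P' J' h')) := by
    rintro P J _ _ _ _ rfl rfl
    rfl
  constructor
  · rintro ⟨-, I, hI, d, a, ha, haI, hS⟩
    have hd : d = 0 := by
      have := ha.1.symm.trans hdim
      have : d + 1 = 1 := by exact_mod_cast this
      omega
    subst hd
    have e1 : Ideal.span (Set.range a) = Ideal.span {a 0} := by rw [range_fin_one]
    have hle : Ideal.span {a 0} ≤ I := (Ideal.span_singleton_le_iff_mem _).2 haI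
    have hnzd := mem_nonZeroDivisors_of_isSystemOfParameters hA (e1 ▸ ha.2)
    obtain ⟨h1, h2⟩ := (aux _ _ _ _ le_sup_right hle e1 (by rw [e1, sup_eq_left.2 hle])).1 hS
    have h3 := pow_three_eq_of_sallyGeneratedInDegreeOne hle h2
    obtain ⟨u, K, hu, hK, h1K, e⟩ := hI.exists_isDualizing (Q := Q) hdim hA haI hnzd
    refine ⟨K, hK, h1K, (pow_three_eq_iff_of_coeSubmodule_eq hu e).1 h3, ?_⟩
    rw [← relLength_eq_of_coeSubmodule_eq hu e]
    exact (sallyHasRank_iff hle hnzd h3 n).1 h1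
  · rintro ⟨K, hK, h1K, h3, hlen⟩
    obtain ⟨c, hcm, hc⟩ := hA
    obtain ⟨d', hd', hle⟩ := exists_span_mul_le hK.fg (exists_unit_mem_one (A := A) (Q := Q))
    -- `d'` clears the denominators of `K`; the extra factor `c ∈ 𝔪` puts `dK` inside `(c)` and so
    -- makes the resulting ideal proper.
    let d := c * d'
    have hd : d ∈ nonZeroDivisors A := mul_mem hc hd'
    have hdm : d ∈ maximalIdeal A := Ideal.mul_mem_right _ _ hcm
    obtain ⟨u, hu⟩ := exists_units_algebraMap (Q := Q) hd
    have hle' : span A {(u : Q)} * K ≤ coeSubmodule Q (Ideal.span {c}) := by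
      rw [hu, map_mul, ← Set.singleton_mul_singleton, ← span_mul_span, mul_assoc,
        coeSubmodule_span_singleton]
      exact (mul_le_mul_of_le _ hle).trans (mul_one _).le
    let I : Ideal A := (span A {(u : Q)} * K).comap (Algebra.linearMap A Q)
    have hI : coeSubmodule Q I = span A {(u : Q)} * K :=
      Submodule.map_comap_eq_self (hle'.trans LinearMap.map_le_range)
    have hIc : I ≤ Ideal.span {c} :=
      (IsLocalization.coeSubmodule_le_coeSubmodule (S := Q) (M := nonZeroDivisors A) le_rfl).1
        (hI.trans_le hle')
    have hdI : d ∈ I := by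
      change algebraMap A Q d ∈ span A {(u : Q)} * K
      have := mul_mem_mul (mem_span_singleton_self (R := A) (u : Q)) (one_le.1 h1K)
      rw [mul_one] at this
      exact (congrArg (· ∈ span A {(u : Q)} * K) hu).mp this
    have hle : Ideal.span {d} ≤ I := (Ideal.span_singleton_le_iff_mem _).2 hdI
    have e1 : Ideal.span (Set.range ![d]) = Ideal.span {d} :=
      congrArg Ideal.span (range_fin_one ![d])
    have h3' := (pow_three_eq_iff_of_coeSubmodule_eq hu hI).2 h3
    refine ⟨hCM, I, ⟨?_, ?_⟩, 0, ![d], ⟨hdim, ?_⟩, hdI, ?_⟩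
    · intro h
      rw [h, top_le_iff, Ideal.span_singleton_eq_top] at hIc
      exact hcm hIc
    · rw [isDualizing_of_isCanonicalIdeal (Q := Q) hdim ⟨c, hcm, hc⟩ ⟨d, hdI, hd⟩, hI]
      exact hK.span_unit_mul u
    · rw [e1, radical_span_singleton_eq_maximalIdeal hd hdm]
    · refine (aux _ _ _ _ le_sup_right hle e1 (by rw [e1, sup_eq_left.2 hle])).2 ⟨?_, ?_⟩
      · rw [sallyHasRank_iff hle hd h3', relLength_eq_of_coeSubmodule_eq hu hI, hlen]
      · exact sallyGeneratedInDegreeOne_of_pow_three_eq hle h3'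

end Goto

/-! ### Principal reductions of powers, over an arbitrary residue field. -/

section HomogeneousReduction

variable {R : Type u} [CommRing R]

/-- The ideal `⨁ I ^ (i + 1) t ^ i` of the Rees algebra of `I`. -/
noncomputable def reesIdeal (I : Ideal R) : Ideal (reesAlgebra I) where
  carrier := {f | ∀ i, (f : R[X]).coeff i ∈ I ^ (i + 1)}
  zero_mem' := fun i => by simp
  add_mem' := fun {f g} hf hg i => by
    change ((f : R[X]) + g).coeff i ∈ _
    rw [coeff_add]
    exact add_mem (hf i) (hg i)
  smul_mem' := fun c f hf i => by
    change ((c : R[X]) * f).coeff i ∈ _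
    rw [coeff_mul]
    refine Ideal.sum_mem _ fun x hx => ?_
    rw [← Finset.HasAntidiagonal.mem_antidiagonal.mp hx, add_assoc, pow_add]
    exact Ideal.mul_mem_mul (c.2 x.1) (hf x.2)

/-- The homogeneous element `z t ^ s` of the Rees algebra. -/
noncomputable def reesMonomial {I : Ideal R} (s : ℕ) (z : ↥(I ^ s)) : reesAlgebra I :=
  ⟨monomial s (z : R), reesAlgebra.monomial_mem.2 z.2⟩

theorem reesMonomial_mul {I : Ideal R} {s t : ℕ} (z : ↥(I ^ s)) (w : ↥(I ^ t)) :
    reesMonomial s z * reesMonomial t w =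
      reesMonomial (s + t) ⟨(z : R) * w, pow_add I s t ▸ Ideal.mul_mem_mul z.2 w.2⟩ :=
  Subtype.ext (monomial_mul_monomial s t (z : R) w)

theorem reesMonomial_pow {I : Ideal R} {s : ℕ} (z : ↥(I ^ s)) (n : ℕ) :
    reesMonomial s z ^ n =
      reesMonomial (s * n) ⟨(z : R) ^ n, pow_mul I s n ▸ Ideal.pow_mem_pow z.2 n⟩ :=
  Subtype.ext (monomial_pow s (z : R) n)

theorem reesMonomial_add {I : Ideal R} {s : ℕ} (z w : ↥(I ^ s)) :
    reesMonomial s (z + w) = reesMonomial s z + reesMonomial s w :=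
  Subtype.ext (map_add (monomial s) (z : R) w)

theorem reesMonomial_mem_reesIdeal {I : Ideal R} {s : ℕ} {z : ↥(I ^ s)}
    (h : (z : R) ∈ I ^ (s + 1)) : reesMonomial s z ∈ reesIdeal I := by
  intro j
  change (monomial s (z : R)).coeff j ∈ _
  rw [coeff_monomial]
  split_ifs with hij
  · exact hij ▸ h
  · exact zero_mem _

/-- If `Z ^ i * W ∈ G` and replacing `Z` by `Z ^ a + W ^ b` does not enlarge the radical of
`G ⊔ (Z)`, then `W` is nilpotent modulo `G`. -/
theorem Ideal.mem_radical_of_maximal {T : Type*} [CommRing T] {G : Ideal T} {Z W : T}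
    {a b i : ℕ} (ha : a ≠ 0) (hb : b ≠ 0) (hmax : (G ⊔ Ideal.span {Z}).radical ≤
      (G ⊔ Ideal.span {Z ^ a + W ^ b}).radical → (G ⊔ Ideal.span {Z ^ a + W ^ b}).radical ≤
      (G ⊔ Ideal.span {Z}).radical)
    (h : Z ^ i * W ∈ G) : W ∈ G.radical := by
  have hG : G ≤ G ⊔ Ideal.span {Z ^ a + W ^ b} := le_sup_left
  have hY : Z ^ a + W ^ b ∈ G ⊔ Ideal.span {Z ^ a + W ^ b} :=
    le_sup_right (a := G) (Ideal.mem_span_singleton_self _)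
  have hZ : Z ∈ (G ⊔ Ideal.span {Z ^ a + W ^ b}).radical := by
    refine ⟨i + a, ?_⟩
    obtain ⟨b', rfl⟩ := Nat.exists_eq_succ_of_ne_zero hb
    have e : Z ^ (i + a) = Z ^ i * (Z ^ a + W ^ b'.succ) - W ^ b' * (Z ^ i * W) := by
      rw [Nat.succ_eq_add_one]
      ring
    rw [e]
    exact sub_mem (Ideal.mul_mem_left _ _ hY) (Ideal.mul_mem_left _ _ (hG h))
  have hZ' : (Ideal.span {Z}) ≤ (G ⊔ Ideal.span {Z ^ a + W ^ b}).radical :=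
    (Ideal.span_singleton_le_iff_mem _).2 hZ
  have hle := hmax (Ideal.radical_le_radical_iff.2 (sup_le (hG.trans Ideal.le_radical) hZ'))
  have hW : W ∈ (G ⊔ Ideal.span {Z}).radical := by
    have h1 : Z ^ a + W ^ b ∈ (G ⊔ Ideal.span {Z ^ a + W ^ b}).radical := Ideal.le_radical hY
    have h2 : W ^ b ∈ (G ⊔ Ideal.span {Z}).radical := by
      have := sub_mem (hle h1) (hle (Ideal.pow_mem_of_mem _ hZ a (Nat.pos_of_ne_zero ha)))
      rwa [add_sub_cancel_left] at this
    exact Ideal.mem_radical_of_pow_mem h2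
  obtain ⟨c, hc⟩ := hW
  obtain ⟨g, hg, y, hy, e⟩ := Submodule.mem_sup.1 hc
  obtain ⟨r, rfl⟩ := Ideal.mem_span_singleton'.1 hy
  refine ⟨c * i + 1, ?_⟩
  have h1 : W ^ c - r * Z ∈ G := by rw [← e, add_sub_cancel_right]; exact hg
  have h2 : (W ^ c) ^ i - (r * Z) ^ i ∈ G :=
    Ideal.mem_of_dvd _ (sub_dvd_pow_sub_pow _ _ i) h1
  have e2 : W ^ (c * i + 1) = ((W ^ c) ^ i - (r * Z) ^ i) * W + r ^ i * (Z ^ i * W) := by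
    rw [pow_succ, pow_mul]
    ring
  rw [e2]
  exact add_mem (Ideal.mul_mem_right _ _ h2) (Ideal.mul_mem_left _ _ h)

variable [IsNoetherianRing R] {I : Ideal R}

/-- Choose `zt^s` with the radical of `reesIdeal I + (zt^s)` maximal. For any `wt^k` with `k ≠ 0`,
the sum `(zt^s)^k + (wt^k)^s` is again homogeneous of positive degree, so it cannot give a larger
radical. This makes `zt^s` regular, modulo the radical of `reesIdeal I`, on homogeneous elements of
positive degree. -/
theorem exists_maximal_reesMonomial (I : Ideal R) :
    ∃ (s : ℕ) (z : ↥(I ^ s)), s ≠ 0 ∧ ∀ (t : ℕ) (w : ↥(I ^ t)), t ≠ 0 →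
      ∀ i, reesMonomial s z ^ i * reesMonomial t w ∈ reesIdeal I →
        reesMonomial t w ∈ (reesIdeal I).radical := by
  let S : Set (Ideal (reesAlgebra I)) := {E | ∃ (s : ℕ) (z : ↥(I ^ s)), s ≠ 0 ∧
    (reesIdeal I ⊔ Ideal.span {reesMonomial s z}).radical = E}
  have hS : S.Nonempty := ⟨_, 1, 0, one_ne_zero, rfl⟩
  obtain ⟨_, ⟨s, z, hs, rfl⟩, hmax⟩ := set_has_maximal_iff_noetherian.2
    (inferInstanceAs (IsNoetherian (reesAlgebra I) (reesAlgebra I))) S hS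
  refine ⟨s, z, hs, fun t w ht i h => ?_⟩
  refine Ideal.mem_radical_of_maximal (a := t) (b := s) ht hs (fun hle => ?_) h
  obtain ⟨y, e⟩ : ∃ y : ↥(I ^ (s * t)),
      reesMonomial s z ^ t + reesMonomial t w ^ s = reesMonomial (s * t) y := by
    refine ⟨⟨(z : R) ^ t, pow_mul I s t ▸ Ideal.pow_mem_pow z.2 t⟩ +
        ⟨(w : R) ^ s, mul_comm t s ▸ pow_mul I t s ▸ Ideal.pow_mem_pow w.2 s⟩, ?_⟩
    rw [reesMonomial_add, reesMonomial_pow, reesMonomial_pow]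
    congr 1
    refine Subtype.ext ?_
    exact congrArg (fun k => monomial k ((w : R) ^ s)) (mul_comm t s)
  by_contra hn
  refine hmax _ ⟨s * t, y, mul_ne_zero hs ht, rfl⟩ ?_
  rw [← e]
  exact lt_of_le_not_ge hle hn

/-- The elements of `I ^ n` whose homogeneous lift of degree `n` is nilpotent modulo `reesIdeal`. -/
noncomputable def reesRadical (I : Ideal R) (n : ℕ) : Ideal R where
  carrier := {w | ∃ h : w ∈ I ^ n, reesMonomial n ⟨w, h⟩ ∈ (reesIdeal I).radical}
  zero_mem' := ⟨zero_mem _, by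
    have : reesMonomial n (⟨0, zero_mem _⟩ : ↥(I ^ n)) = 0 := Subtype.ext (map_zero (monomial n))
    rw [this]
    exact zero_mem _⟩
  add_mem' := fun {v w} ⟨hv, hv'⟩ ⟨hw, hw'⟩ => ⟨add_mem hv hw, by
    have := reesMonomial_add (⟨v, hv⟩ : ↥(I ^ n)) ⟨w, hw⟩
    exact this ▸ add_mem hv' hw'⟩
  smul_mem' := fun r w ⟨hw, hw'⟩ => ⟨Ideal.mul_mem_left _ r hw, by
    have : reesMonomial n (⟨r * w, Ideal.mul_mem_left _ r hw⟩ : ↥(I ^ n)) =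
        algebraMap R _ r * reesMonomial n ⟨w, hw⟩ :=
      Subtype.ext (by
        change monomial n (r * w) = C r * monomial n w
        rw [C_mul_monomial])
    exact this ▸ Ideal.mul_mem_left _ _ hw'⟩

omit [IsNoetherianRing R] in
theorem reesRadical_le (I : Ideal R) (n : ℕ) : reesRadical I n ≤ I ^ n := fun _ ⟨h, _⟩ => h

omit [IsNoetherianRing R] in
theorem pow_succ_le_reesRadical (I : Ideal R) (n : ℕ) : I ^ (n + 1) ≤ reesRadical I n :=
  fun _ h => ⟨Ideal.pow_le_pow_right (Nat.le_succ n) h,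
    Ideal.le_radical (reesMonomial_mem_reesIdeal h)⟩

/-- Multiplication by `z` is injective from degree `n` to degree `n + s` of the Rees algebra modulo
the radical of `reesIdeal I`. The components have bounded length, so it is surjective for some `n`.
-/
theorem exists_pow_le_span_mul_sup (I : Ideal R) {N e : ℕ}
    (hlen : ∀ n, N ≤ n → relLength (I ^ (n + 1)) (I ^ n) ≤ e) :
    ∃ (s n : ℕ) (z : ↥(I ^ s)), s ≠ 0 ∧
      ∀ w ∈ I ^ (n + s), ∃ v ∈ I ^ n, w - z * v ∈ reesRadical I (n + s) := by
  obtain ⟨s, z, hs, hmax⟩ := exists_maximal_reesMonomial I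
  have hz : ∀ n, ∀ v ∈ I ^ n, (z : R) * v ∈ I ^ (n + s) := fun n v hv => by
    rw [add_comm, pow_add]
    exact Ideal.mul_mem_mul z.2 hv
  let f : ∀ n, ↥(I ^ n) →ₗ[R] ↥(I ^ (n + s)) ⧸ (reesRadical I (n + s)).submoduleOf (I ^ (n + s)) :=
    fun n => Submodule.mkQ _ ∘ₗ ((LinearMap.mulLeft R (z : R)).restrict (hz n))
  have hker : ∀ n, n ≠ 0 → LinearMap.ker (f n) = (reesRadical I n).submoduleOf (I ^ n) := by
    intro n hn
    ext v
    rw [LinearMap.mem_ker]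
    have e1 : f n v = 0 ↔ (z : R) * v ∈ reesRadical I (n + s) := Submodule.Quotient.mk_eq_zero _
    have e2 : ∀ h : (z : R) * v ∈ I ^ (n + s), reesMonomial (n + s) ⟨(z : R) * v, h⟩ =
        reesMonomial s z * reesMonomial n v := fun h => by
      rw [reesMonomial_mul]
      refine Subtype.ext ?_
      exact congrArg (fun k => monomial k ((z : R) * v)) (add_comm n s)
    rw [e1]
    constructor
    · rintro ⟨h, c, hc⟩
      refine ⟨v.2, ?_⟩
      by_cases hc0 : c = 0
      · subst hc0
        rw [pow_zero] at hc
        refine Ideal.le_radical ?_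
        have := Ideal.mul_mem_left (reesIdeal I) (reesMonomial n v) hc
        rwa [mul_one] at this
      rw [e2, mul_pow, reesMonomial_pow v] at hc
      have := hmax _ _ (mul_ne_zero hn hc0) c hc
      rw [← reesMonomial_pow] at this
      exact Ideal.mem_radical_of_pow_mem this
    · rintro ⟨h, h'⟩
      refine ⟨hz n v v.2, ?_⟩
      rw [e2]
      exact Ideal.mul_mem_left _ _ h'
  let l : ℕ → ℕ∞ := fun n => relLength (reesRadical I n) (I ^ n)
  have hl : ∀ n, n ≠ 0 → Module.length R (LinearMap.range (f n)) = l n := fun n hn => by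
    rw [← (f n).quotKerEquivRange.length_eq, hker n hn]
    rfl
  have hle : ∀ n, N ≤ n → l n ≤ e := fun n hn =>
    (relLength_mono (pow_succ_le_reesRadical I n) (reesRadical_le I n) le_rfl).trans (hlen n hn)
  obtain ⟨n, hn0, hnN, hn⟩ : ∃ n, n ≠ 0 ∧ N ≤ n ∧ LinearMap.range (f n) = ⊤ := by
    by_contra! hcon
    -- If surjectivity always failed, each step by `s` would raise the length by at least one.
    -- Starting at `N + 1` keeps the degree positive, as injectivity requires.
    have key : ∀ j : ℕ, (j : ℕ∞) ≤ l (N + 1 + j * s) := by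
      intro j
      induction j with
      | zero => exact zero_le
      | succ j ih =>
        have h0 : N + 1 + j * s ≠ 0 := by omega
        have hN : N ≤ N + 1 + j * s := by omega
        have h1 := hcon _ h0 hN
        have h2 := Module.length_eq_add_of_exact (LinearMap.range (f (N + 1 + j * s))).subtype
          (LinearMap.range (f (N + 1 + j * s))).mkQ (Submodule.subtype_injective _)
          (Submodule.mkQ_surjective _) (LinearMap.exact_subtype_mkQ _)
        rw [hl _ h0] at h2
        have h3 : 1 ≤ Module.length R ((↥(I ^ (N + 1 + j * s + s)) ⧸
            (reesRadical I (N + 1 + j * s + s)).submoduleOf (I ^ (N + 1 + j * s + s))) ⧸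
            LinearMap.range (f (N + 1 + j * s))) := by
          rw [Order.one_le_iff_pos, Module.length_pos_iff, Submodule.Quotient.nontrivial_iff]
          exact h1
        have e3 : N + 1 + (j + 1) * s = N + 1 + j * s + s := by ring
        rw [e3]
        push_cast
        exact (add_le_add ih h3).trans h2.ge
    have h1 := (key (e + 1)).trans (hle _ (by omega))
    have : e + 1 ≤ e := by exact_mod_cast h1
    omega
  refine ⟨s, n, z, hs, fun w hw => ?_⟩
  obtain ⟨v, hv⟩ := (hn ▸ Submodule.mem_top : Submodule.Quotient.mk ⟨w, hw⟩ ∈ LinearMap.range (f n))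
  refine ⟨v, v.2, ?_⟩
  exact (Submodule.Quotient.eq ((reesRadical I (n + s)).submoduleOf (I ^ (n + s)))).1 hv.symm

/-- If the lengths of `I ^ n / I ^ (n + 1)` are bounded, then some power of `I` has a principal
reduction. -/
theorem exists_pow_le_span_mul_pow [IsLocalRing R] (hI : I ≤ IsLocalRing.maximalIdeal R) {N e : ℕ}
    (hlen : ∀ n, N ≤ n → relLength (I ^ (n + 1)) (I ^ n) ≤ e) :
    ∃ (s n : ℕ), ∃ z ∈ I ^ s, s ≠ 0 ∧ I ^ (n + s) ≤ Ideal.span {z} * I ^ n := by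
  obtain ⟨s, n, z, hs, h⟩ := exists_pow_le_span_mul_sup I hlen
  let E := reesIdeal I ⊔ Ideal.span {reesMonomial s z}
  let P : Ideal (reesAlgebra I) := Ideal.span {f | ∃ w : ↥(I ^ 1), f = reesMonomial 1 w}
  -- The power `(wt)^(n+s)` is a multiple of `zt^s` plus an element nilpotent modulo `reesIdeal I`.
  have hP : P ≤ E.radical := by
    refine Ideal.span_le.2 ?_
    rintro _ ⟨w, rfl⟩
    have hw : (w : R) ^ (n + s) ∈ I ^ (n + s) :=
      (congrArg (fun J : Ideal R => (w : R) ^ (n + s) ∈ J ^ (n + s)) (pow_one I)).mp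
        (Ideal.pow_mem_pow w.2 (n + s))
    obtain ⟨v, hv, hvI, hv'⟩ := h _ hw
    have e1 : reesMonomial 1 w ^ (n + s) = reesMonomial s z * reesMonomial n ⟨v, hv⟩ +
        reesMonomial (n + s) ⟨_, hvI⟩ := by
      refine Subtype.ext ?_
      change monomial 1 (w : R) ^ (n + s) = monomial s (z : R) * monomial n v +
        monomial (n + s) ((w : R) ^ (n + s) - z * v)
      rw [monomial_pow, monomial_mul_monomial, one_mul, add_comm s n, ← map_add, add_sub_cancel]
    refine Ideal.mem_radical_of_pow_mem (m := n + s) ?_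
    rw [e1]
    refine add_mem (Ideal.mul_mem_right _ _ (Ideal.le_radical ?_)) ?_
    · exact le_sup_right (a := reesIdeal I) (Ideal.mem_span_singleton_self _)
    · exact Ideal.radical_mono le_sup_left hv'
  obtain ⟨l, hl⟩ := Ideal.exists_pow_le_of_le_radical_of_fg hP (IsNoetherian.noetherian _)
  have hmon : ∀ k, ∀ w : ↥(I ^ k), reesMonomial k w ∈ P ^ k := by
    intro k
    induction k with
    | zero => intro w; simp
    | succ k ih =>
      rintro ⟨w, hw⟩
      have hw' := hw
      rw [pow_succ] at hw'
      obtain ⟨_, h⟩ : ∃ hw : w ∈ I ^ (k + 1), reesMonomial (k + 1) ⟨w, hw⟩ ∈ P ^ (k + 1) := by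
        refine Submodule.mul_induction_on hw' ?_ ?_
        · intro x hx y hy
          have hy1 : y ∈ I ^ 1 := by rwa [pow_one]
          refine ⟨pow_succ I k ▸ Ideal.mul_mem_mul hx hy, ?_⟩
          have : reesMonomial k ⟨x, hx⟩ * reesMonomial 1 ⟨y, hy1⟩ ∈ P ^ (k + 1) := by
            rw [pow_succ]
            exact Ideal.mul_mem_mul (ih _) (Ideal.subset_span ⟨_, rfl⟩)
          rwa [reesMonomial_mul] at this
        · rintro x y ⟨hx, hx'⟩ ⟨hy, hy'⟩
          exact ⟨add_mem hx hy, by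
            have := reesMonomial_add (⟨x, hx⟩ : ↥(I ^ (k + 1))) ⟨y, hy⟩
            exact this ▸ add_mem hx' hy'⟩
      exact h
  refine ⟨s, l, z, z.2, hs, ?_⟩
  -- A power of `P` lies in `E`, which in degree `l + s` says `I^(l+s) ⊆ zI^l + I^(l+s+1)`; Nakayama
  -- drops the last term.
  refine Submodule.le_of_le_smul_of_le_jacobson_bot (I := I) (IsNoetherian.noetherian _)
    (hI.trans (IsLocalRing.jacobson_eq_maximalIdeal (⊥ : Ideal R) bot_ne_top).ge) ?_
  intro w hw
  have h1 : reesMonomial (l + s) ⟨w, hw⟩ ∈ E := hl (Ideal.pow_le_pow_right (Nat.le_add_right l s)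
    (hmon _ _))
  obtain ⟨g, hg, y, hy, e1⟩ := Submodule.mem_sup.1 h1
  obtain ⟨r, rfl⟩ := Ideal.mem_span_singleton'.1 hy
  have e2 : (g : R[X]).coeff (l + s) + (r : R[X]).coeff l * z = w := by
    have := congrArg (fun p : reesAlgebra I => (p : R[X]).coeff (l + s)) e1
    change ((g : R[X]) + (r : R[X]) * monomial s (z : R)).coeff (l + s) =
      (monomial (l + s) w).coeff (l + s) at this
    rwa [coeff_add, coeff_mul_monomial, coeff_monomial_same] at this
  rw [← e2, add_comm ((g : R[X]).coeff (l + s)), mul_comm _ (z : R)]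
  refine Submodule.add_mem_sup (Ideal.mul_mem_mul (Ideal.mem_span_singleton_self _) (r.2 l)) ?_
  rw [smul_eq_mul, ← pow_succ']
  exact hg _

end HomogeneousReduction

/-! ### Minimal multiplicity and the blow-up of the maximal ideal. -/

section MinimalMultiplicity

open IsLocalization IsLocalRing Submodule

variable {R : Type u} [CommRing R]

theorem length_quotient_ne_top_of_mem_nonZeroDivisors [IsNoetherianRing R] [Ring.KrullDimLE 1 R]
    {I : Ideal R} {d : R} (hd : d ∈ nonZeroDivisors R) (h : d ∈ I) :
    Module.length R (R ⧸ I) ≠ ⊤ :=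
  Module.length_ne_top_of_smul_eq_zero hd fun m => by
    obtain ⟨r, rfl⟩ := Ideal.Quotient.mk_surjective m
    change Ideal.Quotient.mk I (d * r) = 0
    exact Ideal.Quotient.eq_zero_iff_mem.2 (Ideal.mul_mem_right _ _ h)

section BlowUp

/-- If the blow-up of `I` is local and a power of `I` has a principal reduction, then the extension
of `I` to the blow-up is generated by an element of `I`. -/
theorem exists_forall_exists_mul_eq_of_isLocalRing_blowUp {I : Ideal R}
    [IsLocalRing (blowUp I)] {c : R} (hcI : c ∈ I) (hc : c ∈ nonZeroDivisors R) {s n : ℕ}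
    (hs : s ≠ 0) {z : R} (hzs : z ∈ I ^ s) (h : I ^ (n + s) ≤ Ideal.span {z} * I ^ n) :
    ∃ x ∈ I, ∀ w ∈ I, ∃ β ∈ blowUp I,
      algebraMap R (FractionRing R) x * β = algebraMap R (FractionRing R) w := by
  obtain ⟨v, -, hv⟩ := Ideal.mem_span_singleton_mul.1 (h (Ideal.pow_mem_pow hcI (n + s)))
  have hz : z ∈ nonZeroDivisors R := (mul_mem_nonZeroDivisors.1 (hv ▸ pow_mem hc (n + s))).1
  obtain ⟨u, hu⟩ := exists_units_algebraMap (Q := FractionRing R) hz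
  -- `y/z` lies in the blow-up, as it maps `I^n` into itself by `I^(n+s) ⊆ zI^n`.
  have hB : ∀ y ∈ I ^ s, ∃ b : blowUp I, (b : FractionRing R) * u = algebraMap R _ y := by
    intro y hy
    refine ⟨⟨algebraMap R _ y * ((u⁻¹ : (FractionRing R)ˣ) : FractionRing R), n, fun w hw => ?_⟩,
      Units.inv_mul_cancel_right _ u⟩
    have h1 : y * w ∈ Ideal.span {z} * I ^ n := h (by
      rw [add_comm, pow_add]
      exact Ideal.mul_mem_mul hy hw)
    obtain ⟨v, hv, e⟩ := Ideal.mem_span_singleton_mul.1 h1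
    refine ⟨v, hv, ?_⟩
    rw [mul_right_comm, Units.mul_inv_eq_iff_eq_mul, hu, ← map_mul, ← map_mul, ← e, mul_comm]
  obtain ⟨s, rfl⟩ := Nat.exists_eq_succ_of_ne_zero hs
  have hmul : ∀ x ∈ I, ∀ v ∈ I ^ s, x * v ∈ I ^ (s + 1) := fun x hx v hv => by
    rw [pow_succ']
    exact Ideal.mul_mem_mul hx hv
  -- `z` is a sum of products `xv`. If all the `xv/z` were nonunits of the local ring, so would be
  -- their sum `z/z = 1`. A unit `xv/z` then gives `w/x = (wv/z)/(xv/z)` in the blow-up for every `w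
  -- ∈ I`.
  obtain ⟨x, hx, v, hv, b, hb, hunit⟩ : ∃ x ∈ I, ∃ v ∈ I ^ s, ∃ b : blowUp I,
      (b : FractionRing R) * u = algebraMap R _ (x * v) ∧ IsUnit b := by
    by_contra! hcon
    have key : ∀ y ∈ I ^ (s + 1), ∃ b : blowUp I, b ∈ maximalIdeal (blowUp I) ∧
        (b : FractionRing R) * u = algebraMap R _ y := by
      intro y hy
      rw [pow_succ'] at hy
      refine Submodule.mul_induction_on hy ?_ ?_
      · intro x hx v hv
        obtain ⟨b, hb⟩ := hB _ (hmul x hx v hv)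
        exact ⟨b, hcon x hx v hv b hb, hb⟩
      · rintro y y' ⟨b, hb, e⟩ ⟨b', hb', e'⟩
        refine ⟨b + b', add_mem hb hb', ?_⟩
        rw [map_add, ← e, ← e', ← add_mul]
        rfl
    obtain ⟨b, hb, e⟩ := key z hzs
    rw [← hu] at e
    have : b = 1 := Subtype.ext (u.isUnit.mul_right_cancel (e.trans (one_mul _).symm))
    exact hb (this ▸ isUnit_one)
  obtain ⟨b', hb'⟩ := hunit.exists_right_inv
  refine ⟨x, hx, fun w hw => ?_⟩
  obtain ⟨a, ha⟩ := hB _ (hmul w hw v hv)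
  refine ⟨_, (a * b').2, ?_⟩
  have e1 : (b : FractionRing R) * b' = 1 := congrArg Subtype.val hb'
  refine u.isUnit.mul_right_cancel ?_
  change algebraMap R _ x * ((a : FractionRing R) * b') * u = _
  rw [map_mul] at ha hb
  linear_combination algebraMap R (FractionRing R) x * b' * ha + algebraMap R _ w * u * e1 -
    algebraMap R _ w * b' * hb

/-- If the blow-up of `I` is local, then a principal reduction of a power of `I` yields one of
`I`. -/
theorem exists_pow_succ_le_span_mul_pow_of_isLocalRing_blowUp {I : Ideal R} (hI : I.FG)
    [IsLocalRing (blowUp I)] {c : R} (hcI : c ∈ I) (hc : c ∈ nonZeroDivisors R) {s n : ℕ}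
    (hs : s ≠ 0) {z : R} (hzs : z ∈ I ^ s) (h : I ^ (n + s) ≤ Ideal.span {z} * I ^ n) :
    ∃ x ∈ I, x ∈ nonZeroDivisors R ∧ ∃ j, ∀ k, j ≤ k → I ^ (k + 1) ≤ Ideal.span {x} * I ^ k := by
  obtain ⟨x, hx, hdiv⟩ := exists_forall_exists_mul_eq_of_isLocalRing_blowUp hcI hc hs hzs h
  let f := algebraMap R (FractionRing R)
  have hinj : Function.Injective f := IsFractionRing.injective R (FractionRing R)
  have hxn : x ∈ nonZeroDivisors R := by
    obtain ⟨β, -, e⟩ := hdiv c hcI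
    refine mem_nonZeroDivisors_iff_right.2 fun r hr => ?_
    have : r * c = 0 := hinj (by rw [map_mul, ← e, mul_left_comm, ← mul_assoc, mul_comm (f x),
      ← map_mul, hr, map_zero, zero_mul])
    exact (mem_nonZeroDivisors_iff_right.1 hc) r this
  refine ⟨x, hx, hxn, ?_⟩
  -- `w = xβ` with `β` stabilizing `I^k` for large `k`. Finitely many generators `w` then share one
  -- bound.
  have hev : ∀ w ∈ I, ∀ᶠ k in Filter.atTop, ∀ y ∈ I ^ k, w * y ∈ Ideal.span {x} * I ^ k := by
    intro w hw
    obtain ⟨β, ⟨m, hm⟩, e⟩ := hdiv w hw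
    refine Filter.eventually_atTop.2 ⟨m, fun k hk y hy => ?_⟩
    obtain ⟨k, rfl⟩ := Nat.exists_eq_add_of_le hk
    obtain ⟨v, hv, e'⟩ := blowUp_aux I β m k hm y hy
    refine Ideal.mem_span_singleton_mul.2 ⟨v, hv, hinj ?_⟩
    rw [map_mul, map_mul, ← e, mul_assoc]
    exact congrArg (f x * ·) e'.symm
  obtain ⟨S, hS⟩ := hI
  have hall := (Filter.eventually_all_finset S).2 fun w hw =>
    hev w (hS ▸ Submodule.subset_span hw)
  obtain ⟨j, hj⟩ := Filter.eventually_atTop.1 hall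
  refine ⟨j, fun k hk => ?_⟩
  rw [pow_succ']
  refine Submodule.mul_le.2 fun w hw y hy => ?_
  rw [← hS] at hw
  induction hw using Submodule.span_induction with
  | mem w hw => exact hj k hk w hw y hy
  | zero => rw [zero_mul]; exact zero_mem _
  | add a b _ _ ha hb => rw [add_mul]; exact add_mem ha hb
  | smul r a _ ha => rw [smul_mul_assoc]; exact Submodule.smul_mem _ r ha

/-- If `I ^ 2 = x I`, then the blow-up of `I` is `x⁻¹ I`. -/
theorem coeSubmodule_eq_span_mul_toSubmodule_blowUp {I : Ideal R} {x : R} (hx : x ∈ I)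
    (h : I ^ 2 = Ideal.span {x} * I) {ξ : (FractionRing R)ˣ}
    (hξ : (ξ : FractionRing R) = algebraMap R (FractionRing R) x) :
    coeSubmodule (FractionRing R) I =
      span R {(ξ : FractionRing R)} * Subalgebra.toSubmodule (blowUp I) := by
  refine le_antisymm ?_ ?_
  · have := (span_unit_mul_le_iff ξ⁻¹ (coeSubmodule (FractionRing R) I)
      (Subalgebra.toSubmodule (blowUp I))).1
    rw [inv_inv] at this
    refine this (Submodule.mul_le.2 fun q hq y hy => ?_)
    obtain ⟨w, hw, rfl⟩ := hy
    obtain ⟨r, rfl⟩ := Submodule.mem_span_singleton.1 hq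
    rw [smul_mul_assoc]
    refine Submodule.smul_mem _ r ⟨1, fun y hy => ?_⟩
    rw [pow_one] at hy ⊢
    have h1 : w * y ∈ I ^ 2 := by
      rw [pow_two]
      exact Ideal.mul_mem_mul hw hy
    rw [h] at h1
    obtain ⟨v, hv, e⟩ := Ideal.mem_span_singleton_mul.1 h1
    refine ⟨v, hv, ?_⟩
    rw [mul_assoc, Units.inv_mul_eq_iff_eq_mul, hξ, ← map_mul, e]
    exact (map_mul (algebraMap R (FractionRing R)) w y).symm
  · refine Submodule.mul_le.2 fun q hq b hb => ?_
    obtain ⟨r, rfl⟩ := Submodule.mem_span_singleton.1 hq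
    rw [smul_mul_assoc]
    refine Submodule.smul_mem _ r ?_
    obtain ⟨n, hn⟩ := hb
    have hpow : ∀ k, I ^ (k + 1) = Ideal.span {x} ^ k * I := by
      intro k
      induction k with
      | zero => simp
      | succ k ih => rw [pow_succ, ih, mul_assoc, ← pow_two, h, pow_succ, mul_assoc]
    -- `b x^(n+1) ∈ I^(n+1) = x^n I`; cancelling `x^n` leaves `bx ∈ I`. The shift by one makes the
    -- formula for `I^(n+1)` applicable.
    obtain ⟨y, hy, e⟩ := blowUp_aux I b n 1 hn (x ^ (n + 1)) (Ideal.pow_mem_pow hx _)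
    rw [hpow, Ideal.span_singleton_pow] at hy
    obtain ⟨v, hv, rfl⟩ := Ideal.mem_span_singleton_mul.1 hy
    refine ⟨v, hv, ?_⟩
    rw [map_pow, map_mul, map_pow, ← hξ] at e
    refine (Units.mul_right_inj (ξ ^ n)).1 ?_
    rw [Units.val_pow_eq_pow_val]
    refine e.symm.trans ?_
    rw [pow_succ]
    ring

end BlowUp

variable [IsLocalRing R] [IsNoetherianRing R]

theorem relLength_maximalIdeal_sq :
    relLength (maximalIdeal R ^ 2) (maximalIdeal R) = ((maximalIdeal R).spanFinrank : ℕ∞) := by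
  have e : (maximalIdeal R ^ 2).submoduleOf (maximalIdeal R) =
      LinearMap.ker (maximalIdeal R).toCotangent := by
    ext x
    exact (Ideal.toCotangent_eq_zero _ x).symm
  rw [spanFinrank_maximalIdeal_eq_finrank_cotangentSpace, ← Module.length_eq_finrank,
    ← Module.length_eq_of_surjective (S := R) (M := CotangentSpace R) residue_surjective, relLength]
  exact ((Submodule.quotEquivOfEq _ _ e).trans
    ((maximalIdeal R).toCotangent.quotKerEquivOfSurjective
      (maximalIdeal R).toCotangent_surjective)).length_eq

/-- For minimal multiplicity, `𝔪 ^ n / 𝔪 ^ (n + 1)` eventually has the length of the cotangent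
space. -/
theorem HasMinimalMultiplicity.exists_relLength_eq [Ring.KrullDimLE 1 R]
    (hmin : HasMinimalMultiplicity R) (hdim : ringKrullDim R = 1)
    (hA : ∃ c ∈ maximalIdeal R, c ∈ nonZeroDivisors R) :
    ∃ N, ∀ n, N ≤ n → relLength (maximalIdeal R ^ (n + 1)) (maximalIdeal R ^ n) =
      ((maximalIdeal R).spanFinrank : ℕ∞) := by
  obtain ⟨c, hcm, hc⟩ := hA
  obtain ⟨d, a, hd, ha, hev⟩ := hmin
  have hd1 : d = 1 := by
    have := hd.symm.trans hdim
    exact_mod_cast this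
  subst hd1
  have hfin : ∀ k, Module.length R (R ⧸ maximalIdeal R ^ k) ≠ ⊤ := fun k =>
    length_quotient_ne_top_of_mem_nonZeroDivisors (pow_mem hc k) (Ideal.pow_mem_pow hcm k)
  obtain ⟨N, hN⟩ := Filter.eventually_atTop.1 hev
  refine ⟨N + 1, fun n hn => ?_⟩
  obtain ⟨n, rfl⟩ := Nat.exists_eq_add_of_le' (Nat.one_le_of_lt hn)
  -- Consecutive values of the linear Hilbert polynomial differ by its leading coefficient, the
  -- multiplicity.
  have h1 := hN n (by omega)
  have h2 := hN (n + 1) (by omega)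
  have h3 := relLength_add (Ideal.pow_le_pow_right (I := maximalIdeal R) (Nat.le_succ (n + 1)))
    (le_top : maximalIdeal R ^ (n + 1) ≤ ⊤)
  rw [relLength_top_eq, relLength_top_eq] at h3
  have f1 := hfin (n + 1)
  have f2 := hfin (n + 1 + 1)
  have f3 : relLength (maximalIdeal R ^ (n + 1 + 1)) (maximalIdeal R ^ (n + 1)) ≠ ⊤ := by
    intro h
    rw [Nat.succ_eq_add_one, h, top_add] at h3
    exact f2 h3
  rw [Nat.succ_eq_add_one] at h3
  lift relLength (maximalIdeal R ^ (n + 1 + 1)) (maximalIdeal R ^ (n + 1)) to ℕ using f3 with l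
  lift Module.length R (R ⧸ maximalIdeal R ^ (n + 1)) to ℕ using f1 with l1
  lift Module.length R (R ⧸ maximalIdeal R ^ (n + 1 + 1)) to ℕ using f2 with l2
  simp [Finset.sum_range_succ] at h1 h2
  norm_cast at h3 ⊢
  zify at h3 ⊢
  linarith

/-- A one-dimensional Cohen-Macaulay local ring of minimal multiplicity whose blow-up is local
has `𝔪 ^ 2 = x 𝔪`. -/
theorem HasMinimalMultiplicity.exists_maximalIdeal_sq_eq [Ring.KrullDimLE 1 R]
    [IsLocalRing (blowUp (maximalIdeal R))]
    (hmin : HasMinimalMultiplicity R) (hdim : ringKrullDim R = 1)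
    (hA : ∃ c ∈ maximalIdeal R, c ∈ nonZeroDivisors R) :
    ∃ x ∈ maximalIdeal R, x ∈ nonZeroDivisors R ∧
      maximalIdeal R ^ 2 = Ideal.span {x} * maximalIdeal R := by
  obtain ⟨N, hN⟩ := hmin.exists_relLength_eq hdim hA
  obtain ⟨c, hcm, hc⟩ := hA
  obtain ⟨s, n, z, hz, hs, h⟩ := exists_pow_le_span_mul_pow (I := maximalIdeal R) le_rfl
    fun n hn => (hN n hn).le
  obtain ⟨x, hxm, hx, j, hj⟩ := exists_pow_succ_le_span_mul_pow_of_isLocalRing_blowUp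
    (IsNoetherian.noetherian _) hcm hc hs hz h
  refine ⟨x, hxm, hx, ?_⟩
  have hle : ∀ I : Ideal R, Ideal.span {x} * I ≤ maximalIdeal R * I := fun I =>
    Ideal.mul_mono_left ((Ideal.span_singleton_le_iff_mem _).2 hxm)
  have hk := hj (max j N) (le_max_left _ _)
  have e1 : maximalIdeal R ^ (max j N + 1) = Ideal.span {x} * maximalIdeal R ^ (max j N) :=
    le_antisymm hk ((hle _).trans (pow_succ' _ _).ge)
  have hunit : ∀ k, ∃ u : (FractionRing R)ˣ,
      (u : FractionRing R) ∈ coeSubmodule (FractionRing R) (maximalIdeal R ^ k) := fun k => by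
    obtain ⟨u, hu⟩ := exists_units_algebraMap (Q := FractionRing R) (pow_mem hc k)
    exact ⟨u, _, Ideal.pow_mem_pow hcm k, hu.symm⟩
  have hfg : ∀ I : Ideal R, (coeSubmodule (FractionRing R) I).FG := fun I =>
    (IsNoetherian.noetherian I).map _
  -- `ℓ(J/xJ)` is the same for all regular ideals `J`. Taking `J = 𝔪` and `J = 𝔪^k` for large `k`
  -- gives `ℓ(𝔪/x𝔪) = ℓ(𝔪^k/𝔪^(k+1)) = μ(𝔪) = ℓ(𝔪/𝔪²)`, which forces `x𝔪 = 𝔪²`.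
  have e2 : relLength (Ideal.span {x} * maximalIdeal R) (maximalIdeal R) =
      ((maximalIdeal R).spanFinrank : ℕ∞) := by
    have := relLength_span_mul_self (hfg _) (hunit 1) (hfg _) (hunit (max j N)) hx
    rw [pow_one, ← coeSubmodule_span_singleton, ← coeSubmodule_mul, ← coeSubmodule_mul,
      relLength_coeSubmodule, relLength_coeSubmodule, ← e1, hN _ (le_max_right _ _)] at this
    exact this
  refine (eq_of_relLength_le ((hle _).trans (pow_two _).ge)
    (Ideal.pow_le_self two_ne_zero) ?_ ?_).symm
  · rw [e2]
    exact ENat.natCast_ne_top _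
  · rw [e2, relLength_maximalIdeal_sq]

end MinimalMultiplicity

/-! ### Stable powers of proportional fractional ideals. -/

section FractionalPowers

open Submodule

variable {A : Type*} [CommRing A] {Q : Type*} [CommRing Q] [Algebra A Q]

theorem Submodule.span_unit_mul_left_cancel {u : Qˣ} {X Y : Submodule A Q}
    (h : span A {(u : Q)} * X = span A {(u : Q)} * Y) : X = Y := by
  rw [← span_inv_mul_cancel u X, h, span_inv_mul_cancel]

theorem Submodule.le_mul_of_one_le {X Y : Submodule A Q} (h : 1 ≤ Y) : X ≤ X * Y :=
  (mul_one X).ge.trans (mul_le_mul_of_le X h)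

theorem Submodule.one_le_pow_of_one_le {X : Submodule A Q} (h : 1 ≤ X) (n : ℕ) : 1 ≤ X ^ n := by
  induction n with
  | zero => rw [pow_zero]
  | succ n ih =>
    rw [pow_succ]
    exact ih.trans (le_mul_of_one_le h)

theorem Submodule.pow_add_eq_of_pow_succ_eq {X : Submodule A Q} {r : ℕ} (h : X ^ (r + 1) = X ^ r)
    (i : ℕ) : X ^ (r + i) = X ^ r := by
  induction i with
  | zero => rfl
  | succ i ih => rw [← add_assoc, pow_succ, ih, ← pow_succ, h]

/-- Among the multiples of a fractional ideal containing one, the square is independent of the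
choice as soon as the powers stabilise. -/
theorem Submodule.pow_three_eq_and_relLength_eq {L L' : Submodule A Q} {f : Qˣ}
    (hf : L' = span A {(f : Q)} * L) (h3 : L' ^ 3 = L' ^ 2) {k : ℕ}
    (hk : L ^ (k + 1) = L ^ k) :
    L ^ 3 = L ^ 2 ∧ relLength L (L ^ 2) = relLength L' (L' ^ 2) := by
  have hF : span A {(f : Q)} ^ (k + 2) = span A {((f ^ (k + 2) : Qˣ) : Q)} := by
    rw [span_pow, Set.singleton_pow, ← Units.val_pow_eq_pow_val]
  have hS : ∀ i, L ^ (k + i) = L ^ k := pow_add_eq_of_pow_succ_eq hk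
  have hT : ∀ i, L' ^ (2 + i) = L' ^ 2 := pow_add_eq_of_pow_succ_eq h3
  have hTS : L' ^ 2 = span A {(f : Q)} ^ (k + 2) * L ^ k := by
    rw [← hT k, add_comm 2 k, hf, mul_pow, hS]
  -- `S = L^k` and `T = L'²` are idempotent with `T = f^(k+2) S`. So `ST = T` and `T = TT = f^(k+2)
  -- ST = f^(k+2) T`; cancelling the unit gives `S = T`.
  have hST : L' ^ 2 = span A {(f : Q)} ^ (k + 2) * L' ^ 2 := by
    have h1 : L' ^ 2 * L' ^ 2 = L' ^ 2 := by rw [← pow_add, hT]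
    have h2 : L ^ k * L' ^ 2 = L' ^ 2 := by
      rw [hTS, mul_left_comm, ← pow_add, hS]
    conv_lhs => rw [← h1]
    nth_rw 1 [hTS]
    rw [mul_assoc, h2]
  have e1 : L ^ k = L' ^ 2 := by
    rw [hF] at hST hTS
    exact span_unit_mul_left_cancel (hTS.symm.trans hST)
  have e2 : span A {(f : Q)} * L ^ k = L ^ k := by
    have h1 : L' * L' ^ 2 = L' ^ 2 := by rw [← pow_succ', h3]
    rw [← e1] at h1
    nth_rw 1 [hf] at h1
    rwa [mul_assoc, ← pow_succ', hk] at h1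
  have e3 : L ^ 2 = L ^ k := by
    have h1 : span A {(f : Q)} * (span A {(f : Q)} * L ^ 2) =
        span A {(f : Q)} * (span A {(f : Q)} * L ^ k) := by
      rw [e2, e2, e1, hf]
      ring
    exact span_unit_mul_left_cancel (span_unit_mul_left_cancel h1)
  refine ⟨?_, ?_⟩
  · rw [pow_succ', e3, ← pow_succ', hk]
  · rw [← relLength_span_unit_mul f, ← hf, e3, e2, e1]

end FractionalPowers

/-! ### Comparing `K` with `KS` when `𝔪 = ξS`. -/

section Overring

open IsLocalization IsLocalRing Submodule

variable {R : Type*} [CommRing R] [IsLocalRing R] [IsNoetherianRing R] [Ring.KrullDimLE 1 R]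
  {Q : Type*} [CommRing Q] [Algebra R Q] [IsFractionRing R Q]

omit [IsNoetherianRing R] [Ring.KrullDimLE 1 R] [IsFractionRing R Q] in
/-- Nakayama's lemma for fractional ideals. -/
theorem Submodule.FG.eq_bot_of_le_coeSubmodule_mul {X : Submodule R Q} (hX : X.FG)
    (h : X ≤ coeSubmodule Q (maximalIdeal R) * X) : X = ⊥ := by
  refine Submodule.eq_bot_of_le_smul_of_le_jacobson_bot (maximalIdeal R) X hX (h.trans ?_)
    (IsLocalRing.jacobson_eq_maximalIdeal (⊥ : Ideal R) bot_ne_top).ge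
  refine Submodule.mul_le.2 ?_
  rintro _ ⟨a, ha, rfl⟩ x hx
  change algebraMap R Q a * x ∈ _
  rw [← Algebra.smul_def]
  exact Submodule.smul_mem_smul ha hx

/-- `K² ⊆ K` means `K ⊆ K : K = 1`. -/
theorem IsDualizing.eq_one_of_sq_le {K : Submodule R Q} (hK : IsDualizing K) (h1 : 1 ≤ K)
    (h : K ^ 2 ≤ K) : K = 1 :=
  le_antisymm (hK.div_self ▸ Submodule.le_div_iff_mul_le.2 ((pow_two K).ge.trans h)) h1

variable {K S : Submodule R Q} {ξ : Qˣ}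

/-- `KS·𝔪 = ξKSS = K𝔪 ⊆ K` gives one inclusion. The other holds because `KS` properly contains `K`,
hence contains its socle extension. -/
theorem IsDualizing.mul_eq_div_maximalIdeal (hK : IsDualizing K) (h1S : 1 ≤ S) (hSS : S * S = S)
    (hS : S.FG) (hm : coeSubmodule Q (maximalIdeal R) = span R {(ξ : Q)} * S)
    (hne : ¬ K * S ≤ K) : K * S = K / coeSubmodule Q (maximalIdeal R) := by
  refine le_antisymm ?_ (hK.div_maximalIdeal_le (le_mul_of_one_le h1S) (hK.fg.mul hS) hne)
  rw [Submodule.le_div_iff_mul_le, hm]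
  have : K * S * (span R {(ξ : Q)} * S) = K * (span R {(ξ : Q)} * (S * S)) := by ring
  rw [this, hSS, ← hm]
  exact (mul_le_mul_of_le _ (coeSubmodule_le_one _)).trans (mul_one K).le

/-- `KS ⊆ K` would force `S ⊆ K : K = 1` and `𝔪 = (ξ)`. Then `ξ⁻¹K = K : 𝔪 ⊆ K²`, whence `ξ⁻¹K^r ⊆
K^(r+2) = K^r`, that is `K^r = 𝔪K^r`, against Nakayama. -/
theorem IsDualizing.not_mul_le (hK : IsDualizing K) (h1K : 1 ≤ K) (h1S : 1 ≤ S)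
    (hm : coeSubmodule Q (maximalIdeal R) = span R {(ξ : Q)} * S) {r : ℕ}
    (hr : K ^ (r + 1) = K ^ r) (hne : ¬ K ^ 2 ≤ K) : ¬ K * S ≤ K := by
  intro h
  have hS : S = 1 := le_antisymm
    (hK.div_self ▸ Submodule.le_div_iff_mul_le.2 (mul_comm K S ▸ h)) h1S
  rw [hS] at hm
  have hKK : K ≤ K ^ 2 := pow_two K ▸ le_mul_of_one_le h1K
  have h2 := hK.div_maximalIdeal_le hKK (hK.fg.pow 2) hne
  rw [hm, div_span_unit_mul, div_one'] at h2
  have h3 : span R {((ξ⁻¹ : Qˣ) : Q)} * K ^ r ≤ K ^ r := by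
    have h4 : span R {((ξ⁻¹ : Qˣ) : Q)} ≤ K ^ 2 := (le_mul_of_one_le h1K).trans h2
    refine (mul_comm _ _).le.trans ((mul_le_mul_of_le _ h4).trans ?_)
    rw [← pow_add, pow_add_eq_of_pow_succ_eq hr]
  rw [span_unit_mul_le_iff, inv_inv] at h3
  rw [mul_one] at hm
  rw [← hm] at h3
  have h4 := (hK.fg.pow r).eq_bot_of_le_coeSubmodule_mul h3
  have h5 := one_le.1 (one_le_pow_of_one_le h1K r)
  have := IsFractionRing.nontrivial R Q
  rw [h4, mem_bot] at h5
  exact one_ne_zero h5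

/-- The invariants of `K` and `K S` when `K ^ 3 = K ^ 2`. -/
theorem IsDualizing.pow_mul_eq (hK : IsDualizing K) (h1K : 1 ≤ K) (h1S : 1 ≤ S) (hSS : S * S = S)
    (hS : S.FG) (hm : coeSubmodule Q (maximalIdeal R) = span R {(ξ : Q)} * S)
    (h3 : K ^ 3 = K ^ 2) (hne : ¬ K ^ 2 ≤ K) :
    K * S = K / coeSubmodule Q (maximalIdeal R) ∧ (K * S) ^ 2 = K ^ 2 ∧ (K * S) ^ 3 = K ^ 2 ∧
      relLength K (K ^ 2) = 1 + relLength (K * S) (K ^ 2) := by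
  have hKK : K ≤ K ^ 2 := pow_two K ▸ le_mul_of_one_le h1K
  have h1 := hK.mul_eq_div_maximalIdeal h1S hSS hS hm (hK.not_mul_le h1K h1S hm h3 hne)
  have h2 : K * S ≤ K ^ 2 := h1 ▸ hK.div_maximalIdeal_le hKK (hK.fg.pow 2) hne
  have h4 : K ^ 2 * S = K ^ 2 := by
    refine le_antisymm ?_ (le_mul_of_one_le h1S)
    calc K ^ 2 * S = K * (K * S) := by ring
      _ ≤ K * K ^ 2 := mul_le_mul_of_le _ h2
      _ = K ^ 2 := by rw [← pow_succ', h3]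
  have h5 : (K * S) ^ 2 = K ^ 2 := by
    calc (K * S) ^ 2 = K ^ 2 * (S * S) := by ring
      _ = K ^ 2 := by rw [hSS, h4]
  refine ⟨h1, h5, ?_, ?_⟩
  · calc (K * S) ^ 3 = (K * S) ^ 2 * (K * S) := by ring
      _ = K * (K ^ 2 * S) := by rw [h5]; ring
      _ = K ^ 2 := by rw [h4, ← pow_succ', h3]
  · rw [relLength_add (le_mul_of_one_le h1S) h2, h1, hK.relLength_socle]

omit [IsNoetherianRing R] [Ring.KrullDimLE 1 R] [IsFractionRing R Q] in
-- If the trace ideal `(1 : K)K` were the whole ring, `K` would be invertible, and cancelling `K^r`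
-- in `K^(r+1) = K^r` would give `K = 1`.
theorem Submodule.one_div_mul_le_coeSubmodule {r : ℕ}
    (hr : K ^ (r + 1) = K ^ r) (hne : K ≠ 1) :
    1 / K * K ≤ coeSubmodule Q (maximalIdeal R) := by
  have h1 : 1 / K * K ≤ 1 := div_mul_le 1 K
  let J : Ideal R := (1 / K * K).comap (Algebra.linearMap R Q)
  have hJ : coeSubmodule Q J = 1 / K * K :=
    Submodule.map_comap_eq_self (h1.trans one_eq_range.le)
  rw [← hJ]
  refine coeSubmodule_mono Q (le_maximalIdeal fun h => hne ?_)
  rw [h, coeSubmodule_top] at hJ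
  have h2 : (1 / K) ^ r * K ^ r = 1 := by rw [← mul_pow, ← hJ, one_pow]
  calc K = (1 / K) ^ r * K ^ r * K := by rw [h2, one_mul]
    _ = (1 / K) ^ r * K ^ (r + 1) := by ring
    _ = 1 := by rw [hr, h2]

/-- The condition `K ^ 3 = K ^ 2` descends from `K S` to `K`. -/
theorem IsDualizing.pow_three_eq_of_mul (hK : IsDualizing K) (h1K : 1 ≤ K) (h1S : 1 ≤ S)
    (hSS : S * S = S) (hS : S.FG)
    (hm : coeSubmodule Q (maximalIdeal R) = span R {(ξ : Q)} * S) {r : ℕ}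
    (hr : K ^ (r + 1) = K ^ r) (hdiv : (K * S) / (K * S) = S) (h3 : (K * S) ^ 3 = (K * S) ^ 2)
    (hne : K * S ≠ (K * S) ^ 2) :
    K ^ 3 = K ^ 2 ∧ relLength K (K ^ 2) = 1 + relLength (K * S) ((K * S) ^ 2) := by
  have hne' : ¬ K ^ 2 ≤ K := by
    intro h
    have := hK.eq_one_of_sq_le h1K h
    rw [this, one_mul, pow_two, hSS] at hne
    exact hne rfl
  have hne1 : K ≠ 1 := by
    rintro rfl
    exact hne' (by rw [one_pow])
  have hKK : K ≤ K ^ 2 := pow_two K ▸ le_mul_of_one_le h1K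
  have h1 := hK.mul_eq_div_maximalIdeal h1S hSS hS hm (hK.not_mul_le h1K h1S hm hr hne')
  have h2 : K * S ≤ K ^ 2 := h1 ▸ hK.div_maximalIdeal_le hKK (hK.fg.pow 2) hne'
  have hL2 : (K * S) ^ 2 = K * (K * S) := by
    calc (K * S) ^ 2 = K * (K * (S * S)) := by ring
      _ = K * (K * S) := by rw [hSS]
  have hL3 : (K * S) ^ 3 = K ^ 3 * S := by
    calc (K * S) ^ 3 = K ^ 3 * (S * S * S) := by ring
      _ = K ^ 3 * S := by rw [hSS, hSS]
  have hK3 : K ^ 3 = (K * S) ^ 2 := by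
    refine le_antisymm ?_ ?_
    · rw [← h3, hL3]
      exact le_mul_of_one_le h1S
    · rw [hL2, pow_succ']
      exact mul_le_mul_of_le _ h2
  have hK4 : K ^ 4 = K ^ 3 := by
    calc K ^ 4 = K * K ^ 3 := by ring
      _ = K * (K * (K * S)) := by rw [hK3, hL2]
      _ = K ^ 3 * S := by ring
      _ = K ^ 3 := by rw [← hL3, h3, hK3]
  -- With `L = KS` and `S = L : L` one has `S : X = L : LX`, so `L² = L³` gives the equality.
  have hSL : S / (K * S) = S / (K * S) ^ 2 := by
    have h4 : ∀ X, S / X = K * S / (K * S * X) := fun X => by rw [← div_div_eq_div_mul', hdiv]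
    rw [h4, h4 ((K * S) ^ 2), ← pow_two, ← pow_succ', h3]
  -- The trace ideal lies in `𝔪 = ξS`, so `1 : K ⊆ ξ(S : L) = ξ(S : L²) = 𝔪 : K³ ⊆ 1 : K³`. Writing
  -- `1 = K : K` turns this into `K : K² ⊆ K : K⁴ = K : K³`, and duality yields `K² = K³`.
  have key : 1 / K ≤ 1 / K ^ 3 := by
    have h4 : 1 / K * (K * S) ≤ span R {(ξ : Q)} * S := by
      have := mul_le_mul_of_le S (one_div_mul_le_coeSubmodule hr hne1)
      rwa [hm, mul_left_comm S (1 / K), mul_comm S K, mul_left_comm S _ S, hSS] at this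
    have h5 : 1 / K ≤ span R {(ξ : Q)} * (S / (K * S) ^ 2) := by
      rw [← hSL, ← span_unit_mul_div, Submodule.le_div_iff_mul_le]
      exact h4
    rw [← span_unit_mul_div, ← hm, ← hK3] at h5
    refine h5.trans (Submodule.le_div_iff_mul_le.2 ((div_mul_le _ _).trans (coeSubmodule_le_one _)))
  rw [← hK.div_self, div_div_eq_div_mul', div_div_eq_div_mul', ← pow_two, ← pow_succ', hK4] at key
  have hunit : ∃ u : Qˣ, (u : Q) ∈ K ^ 2 := ⟨1, one_le.1 (one_le_pow_of_one_le h1K 2)⟩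
  have hle : K ^ 2 ≤ K ^ 3 := pow_succ K 2 ▸ le_mul_of_one_le h1K
  have h23 := hK.eq_of_div_eq hle hunit (hK.fg.pow 3) key
  refine ⟨h23.symm, ?_⟩
  rw [relLength_add (le_mul_of_one_le h1S) h2, h1, hK.relLength_socle, ← h1, h23, hK3]

end Overring

/-! ### Fractional ideals over an intermediate ring. -/

section Subalgebra

open IsLocalization IsLocalRing Submodule

variable {R : Type*} [CommRing R] {Q : Type*} [CommRing Q] [Algebra R Q] (B : Subalgebra R Q)

theorem Submodule.restrictScalars_one : (1 : Submodule B Q).restrictScalars R =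
    Subalgebra.toSubmodule B := by
  ext q
  rw [restrictScalars_mem, mem_one]
  exact ⟨fun ⟨b, hb⟩ => hb ▸ b.2, fun hq => ⟨⟨_, hq⟩, rfl⟩⟩

theorem Submodule.restrictScalars_div (X Y : Submodule B Q) :
    (X / Y).restrictScalars R = X.restrictScalars R / Y.restrictScalars R := by
  ext q
  rw [restrictScalars_mem, mem_div_iff_forall_mul_mem, mem_div_iff_forall_mul_mem]
  rfl

variable {B}

theorem Submodule.toSubmodule_mul_restrictScalars (X : Submodule B Q) :
    Subalgebra.toSubmodule B * X.restrictScalars R = X.restrictScalars R := by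
  rw [← restrictScalars_one, ← restrictScalars_mul, one_mul]

theorem Submodule.restrictScalars_span_singleton_mul (q : Q) (X : Submodule B Q) :
    (span B {q} * X).restrictScalars R = span R {q} * X.restrictScalars R := by
  ext y
  rw [restrictScalars_mem, mem_span_singleton_mul, mem_span_singleton_mul]
  rfl

/-- A fractional ideal stable under `B` is a `B`-module. -/
theorem Submodule.exists_restrictScalars_eq {X : Submodule R Q}
    (h : Subalgebra.toSubmodule B * X ≤ X) : ∃ Y : Submodule B Q, Y.restrictScalars R = X :=
  ⟨{ X with smul_mem' := fun b _ hq => h (Submodule.mul_mem_mul b.2 hq) }, rfl⟩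

theorem Subalgebra.algebraMap_mem_nonZeroDivisors [IsFractionRing R Q] (B : Subalgebra R Q) {s : R}
    (hs : s ∈ nonZeroDivisors R) : algebraMap R B s ∈ nonZeroDivisors B := by
  obtain ⟨u, hu⟩ := exists_units_algebraMap (Q := Q) hs
  refine mem_nonZeroDivisors_iff_right.2 fun b hb => Subtype.val_injective ?_
  have h1 : (b : Q) * u = 0 := by
    rw [hu]
    exact congrArg (algebraMap B Q) hb
  exact (Units.mul_left_eq_zero u).1 h1

theorem Subalgebra.isFractionRing [IsFractionRing R Q] (B : Subalgebra R Q) :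
    IsFractionRing B Q := by
  have hinj : Function.Injective (algebraMap B Q) := Subtype.val_injective
  refine ⟨⟨?_, ?_, ?_⟩⟩
  · rintro ⟨b, hb⟩
    obtain ⟨⟨r, s⟩, e⟩ := IsLocalization.surj (nonZeroDivisors R) (b : Q)
    have hr : r ∈ nonZeroDivisors R := by
      refine mem_nonZeroDivisors_iff_right.2 fun t ht => ?_
      have h1 : algebraMap R B (t * s) * b = 0 := hinj (by
        change algebraMap R Q (t * s) * (b : Q) = 0
        rw [map_mul, mul_assoc, mul_comm _ (b : Q), e, ← map_mul, ht, map_zero])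
      have h2 : algebraMap R Q (t * s) = 0 :=
        congrArg (algebraMap B Q) ((mem_nonZeroDivisors_iff_right.1 hb) _ h1)
      rw [← map_zero (algebraMap R Q)] at h2
      exact (mem_nonZeroDivisors_iff_right.1 s.2) t (IsFractionRing.injective R Q h2)
    obtain ⟨u, hu⟩ := exists_units_algebraMap (Q := Q) hr
    refine isUnit_of_mul_isUnit_left (y := algebraMap R Q s) ?_
    change IsUnit ((b : Q) * _)
    rw [e, ← hu]
    exact u.isUnit
  · intro q
    obtain ⟨⟨r, s⟩, e⟩ := IsLocalization.surj (nonZeroDivisors R) q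
    exact ⟨⟨algebraMap R B r, ⟨_, B.algebraMap_mem_nonZeroDivisors s.2⟩⟩, e⟩
  · intro a b h
    exact ⟨1, by rw [hinj h]⟩

end Subalgebra

/-! ### Lengths and dimension over a local extension. -/

section LocalSubalgebra

open IsLocalization IsLocalRing Submodule

variable {R : Type*} [CommRing R] [IsLocalRing R] {B : Type*} [CommRing B] [IsLocalRing B]
  [Algebra R B]

theorem isLocalHom_of_residueField_algEquiv (e : ResidueField R ≃ₐ[R] ResidueField B) :
    IsLocalHom (algebraMap R B) := by
  refine ⟨fun r hr => ?_⟩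
  by_contra h
  have h1 : algebraMap R (ResidueField R) r = 0 := (residue_eq_zero_iff r).2 h
  have h2 : residue B (algebraMap R B r) = 0 := by
    have := e.commutes r
    rw [h1, map_zero] at this
    exact this.symm
  exact (residue_eq_zero_iff _).1 h2 hr

theorem length_residueField_eq_one_of_algEquiv [IsLocalHom (algebraMap R B)]
    (e : ResidueField R ≃ₐ[R] ResidueField B) :
    Module.length (ResidueField R) (ResidueField B) = 1 := by
  rw [← Module.length_eq_of_surjective (S := R) (M := ResidueField B) residue_surjective,
    ← e.toLinearEquiv.length_eq,
    Module.length_eq_of_surjective (S := R) (M := ResidueField R) residue_surjective]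
  exact Module.length_eq_one _ _

/-- Length over `R` is length over `B` times the residue degree, here one. -/
theorem relLength_restrictScalars {V : Type*} [AddCommGroup V] [Module R V] [Module B V]
    [IsScalarTower R B V] [IsLocalHom (algebraMap R B)]
    (h : Module.length (ResidueField R) (ResidueField B) = 1) (X Y : Submodule B V) :
    relLength (X.restrictScalars R) (Y.restrictScalars R) = relLength X Y := by
  have := IsLocalRing.length_restrictScalars R B (Y ⧸ X.submoduleOf Y)
  rw [h, mul_one] at this
  exact (Submodule.Quotient.restrictScalarsEquiv R (X.submoduleOf Y)).length_eq.trans this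

/-- `B/cB` is a finite `R`-module killed by a regular element, hence Artinian, and dividing by `c`
lowers the dimension by exactly one. -/
theorem ringKrullDim_eq_one_of_finite [IsNoetherianRing R] [Ring.KrullDimLE 1 R]
    [IsNoetherianRing B] [Module.Finite R B] [IsLocalHom (algebraMap R B)] {c : R}
    (hcm : c ∈ maximalIdeal R) (hc : c ∈ nonZeroDivisors R)
    (hcB : algebraMap R B c ∈ nonZeroDivisors B) : ringKrullDim B = 1 := by
  have hcn : algebraMap R B c ∈ maximalIdeal B := (map_mem_nonunits_iff (algebraMap R B) c).2 hcm
  rw [← ringKrullDim_quotient_span_singleton_succ_eq_ringKrullDim_of_mem_nonZeroDivisors hcB hcn]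
  let C := B ⧸ Ideal.span {algebraMap R B c}
  have : Nontrivial C := Ideal.Quotient.nontrivial_iff.2 fun h =>
    hcn (Ideal.span_singleton_eq_top.1 h)
  have hlen : Module.length R C ≠ ⊤ := Module.length_ne_top_of_smul_eq_zero hc fun b => by
    obtain ⟨b, rfl⟩ := Ideal.Quotient.mk_surjective b
    rw [Algebra.smul_def]
    change Ideal.Quotient.mk _ (algebraMap R B c * b) = 0
    exact Ideal.Quotient.eq_zero_iff_mem.2
      (Ideal.mul_mem_right _ _ (Ideal.mem_span_singleton_self _))
  have := (isFiniteLength_iff_isNoetherian_isArtinian.1 (Module.length_ne_top_iff.1 hlen)).2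
  have : IsArtinian C C := isArtinian_of_tower R this
  have : IsArtinianRing C := this
  rw [ringKrullDimZero_iff_ringKrullDim_eq_zero.1 (inferInstanceAs (Ring.KrullDimLE 0 C)), zero_add]

end LocalSubalgebra

/-! ### Dualizing fractional ideals of the overring. -/

section Dualizing

open IsLocalization IsLocalRing Submodule

variable {R : Type*} [CommRing R] [IsLocalRing R] [IsNoetherianRing R] [Ring.KrullDimLE 1 R]
  {Q : Type*} [CommRing Q] [Algebra R Q] [IsFractionRing R Q] {B : Subalgebra R Q} [IsLocalRing B]
  [IsLocalHom (algebraMap R B)]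

/-- The `B`-dualizing fractional ideals induced by an `R`-dualizing one. -/
theorem IsDualizing.exists_restrictScalars_eq_div {K : Submodule R Q} (hK : IsDualizing K)
    (hA : ∃ c ∈ maximalIdeal R, c ∈ nonZeroDivisors R) (hB : (Subalgebra.toSubmodule B).FG)
    (hres : Module.length (ResidueField R) (ResidueField B) = 1) {ξ : Qˣ}
    (hm : coeSubmodule Q (maximalIdeal R) = span R {(ξ : Q)} * Subalgebra.toSubmodule B) :
    ∃ L : Submodule B Q, IsDualizing L ∧
      L.restrictScalars R = K / coeSubmodule Q (maximalIdeal R) := by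
  obtain ⟨c, hcm, hc⟩ := hA
  obtain ⟨u, hu⟩ := exists_units_algebraMap (Q := Q) hc
  have hum : (u : Q) ∈ coeSubmodule Q (maximalIdeal R) := ⟨c, hcm, hu.symm⟩
  obtain ⟨L, hL⟩ := exists_restrictScalars_eq (B := B)
    (X := K / coeSubmodule Q (maximalIdeal R)) (by
      rw [Submodule.le_div_iff_mul_le, hm]
      have : Subalgebra.toSubmodule B * (K / (span R {(ξ : Q)} * Subalgebra.toSubmodule B)) *
          (span R {(ξ : Q)} * Subalgebra.toSubmodule B) =
          K / (span R {(ξ : Q)} * Subalgebra.toSubmodule B) * (span R {(ξ : Q)} *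
            (Subalgebra.toSubmodule B * Subalgebra.toSubmodule B)) := by ring
      rw [this, B.isIdempotentElem_toSubmodule.eq]
      exact div_mul_le _ _)
  refine ⟨L, ⟨?_, ?_, ?_⟩, hL⟩
  · refine FG.of_restrictScalars R ?_
    rw [hL]
    exact fg_div hK.fg ⟨u, hum⟩
  · obtain ⟨v, hv⟩ := hK.exists_unit
    exact ⟨v, (hL.ge (le_div_coeSubmodule K _ hv) :)⟩
  · let N : Submodule R Q := (coeSubmodule Q (maximalIdeal B)).restrictScalars R
    have h1 : coeSubmodule Q (maximalIdeal R) * N = span R {(ξ : Q)} * N := by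
      rw [hm, mul_assoc, toSubmodule_mul_restrictScalars]
    have huN : (u : Q) ∈ N :=
      ⟨algebraMap R B c, (map_mem_nonunits_iff (algebraMap R B) c).2 hcm, hu.symm⟩
    have hNB : N ≤ Subalgebra.toSubmodule B := by
      rw [← restrictScalars_one]
      exact coeSubmodule_le_one (maximalIdeal B)
    rw [← relLength_restrictScalars hres, restrictScalars_div, hL, div_div_eq_div_mul']
    change relLength _ (K / (coeSubmodule Q (maximalIdeal R) * N)) = 1
    rw [h1, hm, hK.relLength_div (mul_le_mul_of_le _ hNB)
      ⟨ξ * u, mul_mem_mul (mem_span_singleton_self _) huN⟩ ((fg_span_singleton _).mul hB),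
      relLength_span_unit_mul, ← restrictScalars_one, relLength_restrictScalars hres,
      ← coeSubmodule_top]
    have := B.isFractionRing
    rw [relLength_coeSubmodule, relLength_top_eq]
    exact Module.length_eq_one_iff.2 (isSimpleModule_iff_isCoatom.2 (maximalIdeal.isMaximal B).out)

/-- `KB` is `K : 𝔪` unless `KB = K`. In that case `B = R` and `K : 𝔪 = ξ⁻¹K`, so multiplying by `ξ`
repairs it. -/
theorem IsDualizing.exists_restrictScalars_eq_mul {K : Submodule R Q} (hK : IsDualizing K)
    (hA : ∃ c ∈ maximalIdeal R, c ∈ nonZeroDivisors R) (hB : (Subalgebra.toSubmodule B).FG)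
    (hres : Module.length (ResidueField R) (ResidueField B) = 1) {ξ : Qˣ}
    (hm : coeSubmodule Q (maximalIdeal R) = span R {(ξ : Q)} * Subalgebra.toSubmodule B) :
    ∃ L : Submodule B Q, IsDualizing L ∧
      L.restrictScalars R = K * Subalgebra.toSubmodule B := by
  obtain ⟨L, hL, e⟩ := hK.exists_restrictScalars_eq_div hA hB hres hm
  have h1B : 1 ≤ Subalgebra.toSubmodule B := one_le.2 B.one_mem
  by_cases h : K * Subalgebra.toSubmodule B ≤ K
  · have hB1 : Subalgebra.toSubmodule B = 1 := le_antisymm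
      (hK.div_self ▸ Submodule.le_div_iff_mul_le.2 (mul_comm K _ ▸ h)) h1B
    refine ⟨span B {(ξ : Q)} * L, hL.span_unit_mul ξ, ?_⟩
    rw [restrictScalars_span_singleton_mul, e, hm, div_span_unit_mul, span_unit_mul_cancel, hB1,
      div_one', mul_one]
  · exact ⟨L, hL, e.trans (hK.mul_eq_div_maximalIdeal h1B
      B.isIdempotentElem_toSubmodule.eq hB hm h).symm⟩

end Dualizing

/-! ### The equivalence for `R` and its blow-up. -/

section Main

open IsLocalization IsLocalRing Submodule

/-- A canonical ideal with a principal reduction yields a dualizing fractional ideal with stable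
powers. -/
theorem exists_isDualizing_pow_succ_eq {A : Type u} [CommRing A] [IsLocalRing A]
    {Q : Type*} [CommRing Q] [Algebra A Q] [IsFractionRing A Q]
    (hCM : IsCohenMacaulayLocal A) (hdim : ringKrullDim A = 1)
    {I : Ideal A} {a : A} (hI : IsCanonicalIdeal I) (ha : IsSystemOfParameters ![a])
    (hred : IsReduction (Ideal.span {a}) I) :
    ∃ (K : Submodule A Q) (r : ℕ), IsDualizing K ∧ 1 ≤ K ∧ K ^ (r + 1) = K ^ r := by
  have := hCM.1
  have := krullDimLE_one_of_ringKrullDim_eq hdim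
  have hA := hCM.exists_mem_nonZeroDivisors hdim
  obtain ⟨hle, r, hr⟩ := hred
  have e : Ideal.span (Set.range ![a]) = Ideal.span {a} := congrArg Ideal.span (range_fin_one ![a])
  have hna := mem_nonZeroDivisors_of_isSystemOfParameters hA (e ▸ ha.2)
  obtain ⟨u, K, hu, hK, h1, hIK⟩ := hI.exists_isDualizing (Q := Q) hdim hA
    ((Ideal.span_singleton_le_iff_mem _).1 hle) hna
  refine ⟨K, r, hK, h1, ?_⟩
  have h2 := congrArg (coeSubmodule Q) hr
  rw [coeSubmodule_mul, coeSubmodule_pow, coeSubmodule_pow, coeSubmodule_span_singleton, ← hu, hIK,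
    mul_pow, mul_pow, ← mul_assoc, ← pow_succ', span_pow, Set.singleton_pow,
    ← Units.val_pow_eq_pow_val] at h2
  exact span_unit_mul_left_cancel h2

/-- The Goto property of a ring `R` of dimension one and of a local overring `B` with the same
residue field, when the maximal ideal of `R` is isomorphic to `B`. -/
theorem isGoto_iff_isGoto_subalgebra {R : Type u} [CommRing R] [IsLocalRing R]
    {Q : Type u} [CommRing Q] [Algebra R Q] [IsFractionRing R Q]
    (hCM : IsCohenMacaulayLocal R) (hdim : ringKrullDim R = 1)
    (hK : ∃ (K : Submodule R Q) (r : ℕ), IsDualizing K ∧ 1 ≤ K ∧ K ^ (r + 1) = K ^ r)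
    {B : Subalgebra R Q} [IsLocalRing B] (hres : Nonempty (ResidueField R ≃ₐ[R] ResidueField B))
    {ξ : Qˣ} (hm : coeSubmodule Q (maximalIdeal R) = span R {(ξ : Q)} * Subalgebra.toSubmodule B)
    {n : ℕ} (hn : 2 ≤ n) : IsGoto n R ↔ IsGoto (n - 1) B := by
  have := hCM.1
  have := krullDimLE_one_of_ringKrullDim_eq hdim
  have hA := hCM.exists_mem_nonZeroDivisors hdim
  obtain ⟨e⟩ := hres
  have := isLocalHom_of_residueField_algEquiv e
  have hres := length_residueField_eq_one_of_algEquiv e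
  have := B.isFractionRing
  have hBfg : (Subalgebra.toSubmodule B).FG := by
    rw [← span_inv_mul_cancel ξ (Subalgebra.toSubmodule B), ← hm]
    exact (fg_span_singleton _).mul ((IsNoetherian.noetherian (maximalIdeal R)).map _)
  have : Module.Finite R B := Module.Finite.iff_fg.2 hBfg
  have : IsNoetherianRing B := IsNoetherianRing.of_finite R B
  have hA' := hA
  obtain ⟨c, hcm, hc⟩ := hA'
  have hcm' : algebraMap R B c ∈ maximalIdeal B := (map_mem_nonunits_iff (algebraMap R B) c).2 hcm
  have hc' : algebraMap R B c ∈ nonZeroDivisors B := B.algebraMap_mem_nonZeroDivisors hc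
  have hdimB : ringKrullDim B = 1 := ringKrullDim_eq_one_of_finite hcm hc hc'
  have := krullDimLE_one_of_ringKrullDim_eq hdimB
  have hCMB := isCohenMacaulayLocal_of_mem_nonZeroDivisors hdimB hcm' hc'
  have h1B : 1 ≤ Subalgebra.toSubmodule B := one_le.2 B.one_mem
  have hBB := B.isIdempotentElem_toSubmodule.eq
  have hinj := Submodule.restrictScalars_injective R B Q
  have hrel := relLength_restrictScalars (R := R) (B := B) (V := Q) hres
  have hone : ∀ {K : Submodule R Q} {L : Submodule B Q}, 1 ≤ K →
      L.restrictScalars R = K * Subalgebra.toSubmodule B → 1 ≤ L := by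
    intro K L h1K hL
    rw [Submodule.one_le]
    have : (1 : Q) ∈ K * Subalgebra.toSubmodule B := one_le.1 (h1K.trans (le_mul_of_one_le h1B))
    rw [← hL] at this
    exact this
  have hn1 : n = 1 + (n - 1) := by omega
  rw [isGoto_iff_exists_isDualizing (Q := Q) hCM hdim,
    isGoto_iff_exists_isDualizing (Q := Q) hCMB hdimB]
  constructor
  · rintro ⟨K, hK, h1K, h3, hlen⟩
    have hne : ¬ K ^ 2 ≤ K := by
      rw [← relLength_eq_zero_iff, hlen]
      exact_mod_cast (by omega : n ≠ 0)
    obtain ⟨L, hL, e⟩ := hK.exists_restrictScalars_eq_mul hA hBfg hres hm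
    obtain ⟨-, h5, h6, h7⟩ := hK.pow_mul_eq h1K h1B hBB hBfg hm h3 hne
    refine ⟨L, hL, hone h1K e, hinj ?_, ?_⟩
    · rw [restrictScalars_pow three_ne_zero, restrictScalars_pow two_ne_zero, e, h5, h6]
    · rw [← hrel, restrictScalars_pow two_ne_zero, e, h5]
      rw [hlen, hn1] at h7
      push_cast at h7
      exact (WithTop.add_left_cancel (ENat.natCast_ne_top 1) h7).symm
  · rintro ⟨L', hL', h1L', h3, hlen⟩
    -- The witness for `R` is the given `K` with stable powers. Uniqueness of dualizing ideals over
    -- `B` relates `KB` to `L'` by a unit, and stability of powers transfers the invariants.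
    obtain ⟨K, r, hK, h1K, hr⟩ := hK
    refine ⟨K, hK, h1K, ?_⟩
    obtain ⟨L, hL, e⟩ := hK.exists_restrictScalars_eq_mul hA hBfg hres hm
    obtain ⟨f, hf⟩ := hL.exists_eq_span_unit_mul hL' ⟨_, hcm', hc'⟩
    have hBpow : ∀ k, Subalgebra.toSubmodule B ^ (k + 1) = Subalgebra.toSubmodule B := fun k =>
      B.isIdempotentElem_toSubmodule.pow_succ_eq k
    have hk : L ^ (r + 1 + 1) = L ^ (r + 1) := by
      refine hinj ?_
      rw [restrictScalars_pow (Nat.succ_ne_zero _), restrictScalars_pow (Nat.succ_ne_zero _), e,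
        mul_pow, mul_pow, hBpow, hBpow, pow_succ K, hr, ← pow_succ, hr]
    obtain ⟨h4, h5⟩ := pow_three_eq_and_relLength_eq hf h3 hk
    rw [hlen, ← hrel, restrictScalars_pow two_ne_zero, e] at h5
    have hdiv : (K * Subalgebra.toSubmodule B) / (K * Subalgebra.toSubmodule B) =
        Subalgebra.toSubmodule B := by
      rw [← e, ← restrictScalars_div, hL.div_self, restrictScalars_one]
    have h6 : (K * Subalgebra.toSubmodule B) ^ 3 = (K * Subalgebra.toSubmodule B) ^ 2 := by
      rw [← e, ← restrictScalars_pow three_ne_zero, h4, restrictScalars_pow two_ne_zero]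
    -- Here `n ≥ 2` is essential: the rank `n - 1` over `B` must be nonzero.
    have hne : K * Subalgebra.toSubmodule B ≠ (K * Subalgebra.toSubmodule B) ^ 2 := by
      intro h
      rw [← h, relLength_eq_zero_iff.2 le_rfl] at h5
      have : n - 1 = 0 := by exact_mod_cast h5.symm
      omega
    obtain ⟨h7, h8⟩ := hK.pow_three_eq_of_mul h1K h1B hBB hBfg hm hr hdiv h6 hne
    refine ⟨h7, ?_⟩
    rw [h8, h5]
    exact_mod_cast hn1.symm

end Main

theorem theorem4 {R : Type u} [CommRing R] [IsLocalRing R]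
    (hCM : IsCohenMacaulayLocal R) (hdim : ringKrullDim R = 1)
    (hI : ∃ (I : Ideal R) (a : R), IsCanonicalIdeal I ∧ IsSystemOfParameters ![a] ∧
      IsReduction (Ideal.span {a}) I)
    (hmin : HasMinimalMultiplicity R)
    [IsLocalRing (blowUp (IsLocalRing.maximalIdeal R))]
    (hres : Nonempty (IsLocalRing.ResidueField R ≃ₐ[R]
      IsLocalRing.ResidueField (blowUp (IsLocalRing.maximalIdeal R))))
    (n : ℕ) (hn : 2 ≤ n) :
    IsGoto n R ↔ IsGoto (n - 1) (blowUp (IsLocalRing.maximalIdeal R)) := by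
  have := hCM.1
  have := krullDimLE_one_of_ringKrullDim_eq hdim
  obtain ⟨I, a, hI, ha, hred⟩ := hI
  obtain ⟨x, hxm, hx, hsq⟩ := hmin.exists_maximalIdeal_sq_eq hdim
    (hCM.exists_mem_nonZeroDivisors hdim)
  obtain ⟨ξ, hξ⟩ := exists_units_algebraMap (Q := FractionRing R) hx
  exact isGoto_iff_isGoto_subalgebra hCM hdim (exists_isDualizing_pow_succ_eq hCM hdim hI ha hred)
    hres (coeSubmodule_eq_span_mul_toSubmodule_blowUp hxm hsq hξ) hn
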